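/- **Definitions.** A function $F:[0,\infty]^4\to[0,\infty]$ is *admissible* if it is weakly increasing for the product order and $x l_y+y l_x\le F(x,y,l_x,l_y)$ for all finite $x,y,l_x,l_y\geq 0$; we assume throughout that moreover $F$ is finite on $[0,\infty)^4$. For a unital C*-algebra $\mathfrak A\neq 0$ let $\mathfrak{sa}(\mathfrak A)$ be its self-adjoint part and $\mathscr S(\mathfrak A)$ its state space. An *$F$-quasi-Leibniz quantum compact metric space* $(\mathfrak A,\mathsf L)$ is such an $\mathfrak A$ with a seminorm $\mathsf L$ on a dense real subspace $\mathrm{dom}(\mathsf L)$ of $\mathfrak{sa}(\mathfrak A)$, closed under $a\circ b=\frac{ab+ba}{2}$ and $\{a,b\}=\frac{ab-ba}{2i}$, such that: $\mathsf L(a)=0$ iff $a\in\mathbb R1$; $\mathsf{mk}_{\mathsf L}(\varphi,\psi)=\sup\{|\varphi(a)-\psi(a)|:\mathsf L(a)\le1\}$ is a (finite) metric inducing the weak* topology on $\mathscr S(\mathfrak A)$; $\max\{\mathsf L(a\circ b),\mathsf L(\{a,b\})\}\le F(\|a\|,\|b\|,\mathsf L(a),\mathsf L(b))$ on $\mathrm{dom}(\mathsf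 L)$; and $\mathsf L$, extended by $\infty$, is norm lower semicontinuous on $\mathfrak{sa}(\mathfrak A)$. A *Lipschitz linear map* $(\mathfrak A,\mathsf L_{\mathfrak A})\to(\mathfrak B,\mathsf L_{\mathfrak B})$ is a unital continuous linear map $\mathfrak A\to\mathfrak B$ mapping $\mathrm{dom}(\mathsf L_{\mathfrak A})$ into $\mathrm{dom}(\mathsf L_{\mathfrak B})$; it is a *Lipschitz morphism* if it is also a *-homomorphism. The Monge–Kantorovich distance of two such maps is $\mathsf{mkD}_{\mathsf L_{\mathfrak A}}(\varphi,\psi)=\sup\{\|\varphi(a)-\psi(a)\|_{\mathfrak B}:\mathsf L_{\mathfrak A}(a)\le1\}$. A *quantum isometry* $\pi:(\mathfrak A,\mathsf L_{\mathfrak A})\to(\mathfrak B,\mathsf L_{\mathfrak B})$ is a surjective *-homomorphism with $\mathsf L_{\mathfrak B}(b)=\inf\{\mathsf L_{\mathfrak A}(a):\pi(a)=b\}$ for all $b\in\mathfrak{sa}(\mathfrak B)$; a *full quantum isometry* is a *-isomorphism $\pi$ with $\mathsf L_{\mathfrak B}\circ\pi=\mathsf L_{\mathfrak A}$. An *$F$-tunnel*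 $\tau=(\mathfrak D,\mathsf L_{\mathfrak D},\pi_1,\pi_2)$ from $(\mathfrak A_1,\mathsf L_1)$ to $(\mathfrak A_2,\mathsf L_2)$ consists of an $F$-quasi-Leibniz quantum compact metric space $(\mathfrak D,\mathsf L_{\mathfrak D})$ and quantum isometries $\pi_j:(\mathfrak D,\mathsf L_{\mathfrak D})\to(\mathfrak A_j,\mathsf L_j)$; its *extent* $\chi(\tau)$ is the larger of the two Hausdorff distances, for $\mathsf{mk}_{\mathsf L_{\mathfrak D}}$, between $\mathscr S(\mathfrak D)$ and $\{\varphi\circ\pi_j:\varphi\in\mathscr S(\mathfrak A_j)\}$, $j=1,2$. A class $\mathcal T$ of $F$-tunnels is *appropriate* for a nonempty class $\mathcal C$ of $F$-quasi-Leibniz quantum compact metric spaces if: tunnels in $\mathcal T$ have domain and codomain in $\mathcal C$; any two elements of $\mathcal C$ are joined by a tunnel in $\mathcal T$; $\mathcal T$ is stable under exchanging $\pi_1$ and $\pi_2$; for every full quantum isometry $h:(\mathfrak A,\mathsf L_{\mathfrak A})\to(\mathfrak B,\mathsf L_{\mathfrak B})$ between elements of $\mathcal C$, the tunnels $(\mathfrak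 A,\mathsf L_{\mathfrak A},\mathrm{id},h)$ and $(\mathfrak B,\mathsf L_{\mathfrak B},h^{-1},\mathrm{id})$ are in $\mathcal T$; and for $\tau,\gamma\in\mathcal T$ with the codomain of $\tau$ equal to the domain of $\gamma$ and all $\varepsilon>0$ there is a tunnel in $\mathcal T$ from the domain of $\tau$ to the codomain of $\gamma$ of extent $<\chi(\tau)+\chi(\gamma)+\varepsilon$. The *$\mathcal T$-propinquity* between two elements of $\mathcal C$ is the infimum of the extents of the tunnels in $\mathcal T$ from the first to the second. A *compact metric monoid* $(G,\delta)$ is a monoid, with unit $e$, with a compact metric for which the multiplication is continuous. An *$\varepsilon$-near isometric isomorphism* from $(G_1,\delta_1)$ to $(G_2,\delta_2)$ is a pair of functions $\varsigma_1:G_1\to G_2$, $\varsigma_2:G_2\to G_1$ such that for $\{j,k\}=\{1,2\}$ and all $g,g'\in G_j$: $\delta_k(\varsigma_j(g)\varsigma_j(g'),\varsigma_j(gg'))\le\varepsilon$, $\delta_j(\varsigma_k(\varsigma_j(g)),g)\le\varepsilon$, $|\delta_k(\varsigma_j(g),\varsigma_j(g'))-\delta_j(g,g')|\le\varepsilon$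 and $\delta_k(\varsigma_j(e_j),e_k)\le\varepsilon$. An action of a monoid $G$ by Lipschitz linear endomorphisms of $(\mathfrak A,\mathsf L)$ is a map $g\mapsto\alpha^g$ into the Lipschitz linear maps of $(\mathfrak A,\mathsf L)$ to itself, with $\alpha^{gh}=\alpha^g\circ\alpha^h$ and $\alpha^e=\mathrm{id}$; it is strongly continuous if $g\mapsto\alpha^g(a)$ is norm continuous for all $a\in\mathfrak A$. **Theorem.** Let $(G,\delta_G)$ and $(G_n,\delta_n)$, $n\in\mathbb N$, be compact metric monoids, let $\varepsilon_n>0$ with $\varepsilon_n\to0$, and for each $n$ let $(\varsigma_n,\varkappa_n)$ be an $\varepsilon_n$-near isometric isomorphism from $(G_n,\delta_n)$ to $(G,\delta_G)$. Let $D:G\to[0,\infty)$ and $K:[0,\infty)\to[0,\infty)$ be continuous with $K(0)=0$. Let $\mathcal T$ be a class of $F$-tunnels appropriate for a nonempty class $\mathcal C$ of $F$-quasi-Leibniz quantum compact metric spaces, let $(\mathfrak A_n,\mathsf L_n)_{n\in\mathbb N}$ and $(\mathfrak A,\mathsf L)$ be in $\mathcal C$, and suppose that the $\mathcal T$-propinquity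 between $(\mathfrak A_n,\mathsf L_n)$ and $(\mathfrak A,\mathsf L)$ tends to $0$. For each $n$ let $\alpha_n$ be an action of $G_n$ by Lipschitz linear endomorphisms of $(\mathfrak A_n,\mathsf L_n)$ such that, for all $g,g'\in G_n$ and $a\in\mathrm{dom}(\mathsf L_n)$, $$\|\alpha_n^g\|\le D(\varsigma_n(g)),\quad \mathsf L_n(\alpha_n^g(a))\le D(\varsigma_n(g))\,\mathsf L_n(a),\quad \|\alpha_n^g(a)-\alpha_n^{g'}(a)\|\le K(\delta_n(g,g'))\,\mathsf L_n(a).$$ Then there is a strongly continuous action $\alpha$ of $G$ by Lipschitz linear endomorphisms of $(\mathfrak A,\mathsf L)$ such that, for all $g,h\in G$ and $a\in\mathrm{dom}(\mathsf L)$, $$\|\alpha^g\|\le D(g),\quad \mathsf L(\alpha^g(a))\le D(g)\,\mathsf L(a),\quad \|\alpha^g(a)-\alpha^h(a)\|\le \mathsf L(a)\,K(\delta_G(g,h)),$$ $$\liminf_{n\to\infty}\mathsf{mkD}_{\mathsf L_n}\big(\alpha_n^{\varkappa_n(g)},\alpha_n^{\varkappa_n(h)}\big)\le\mathsf{mkD}_{\mathsf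 L}(\alpha^g,\alpha^h)\le\limsup_{n\to\infty}\mathsf{mkD}_{\mathsf L_n}\big(\alpha_n^{\varkappa_n(g)},\alpha_n^{\varkappa_n(h)}\big).$$ If moreover every $\alpha_n^g$ ($n\in\mathbb N$, $g\in G_n$) is positive (resp. a Lipschitz morphism), then every $\alpha^g$ ($g\in G$) is positive (resp. a Lipschitz morphism). -/

import Mathlib

open Filter Topology
open scoped ENNReal NNReal ComplexOrder

universe u v w

/-- Admissible functions `[0,∞]⁴ → [0,∞]`: weakly increasing for the product order, and bounding
`(x, y, lx, ly) ↦ x ly + y lx` from above. -/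
structure IsAdmissible (F : ℝ≥0∞ → ℝ≥0∞ → ℝ≥0∞ → ℝ≥0∞ → ℝ≥0∞) : Prop where
  mono : ∀ ⦃x x' y y' lx lx' ly ly' : ℝ≥0∞⦄, x ≤ x' → y ≤ y' → lx ≤ lx' → ly ≤ ly' →
    F x y lx ly ≤ F x' y' lx' ly'
  leibniz_le : ∀ x y lx ly : ℝ≥0, (x * ly + y * lx : ℝ≥0∞) ≤ F x y lx ly

section CStar

variable {A : Type u} [CStarAlgebra A]

/-- The Jordan product `(ab + ba) / 2`. -/
noncomputable def jordanProd (a b : A) : A := (1 / 2 : ℂ) • (a * b + b * a)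

/-- The Lie product `(ab - ba) / (2i)`. -/
noncomputable def lieProd (a b : A) : A := (1 / (2 * Complex.I) : ℂ) • (a * b - b * a)

variable (A) in
/-- The state space: positive linear functionals that map the unit to `1`, inside the dual of `A`
with its weak* topology. -/
def stateSpace : Set (WeakDual ℂ A) := {φ | φ 1 = 1 ∧ ∀ a : A, 0 ≤ φ (star a * a)}

/-- The Monge–Kantorovich metric of `L`. The function `L` is defined on all of `A`, with value `∞`
outside its domain. -/
noncomputable def kantorovich (L : A → ℝ≥0∞) (φ ψ : WeakDual ℂ A) : ℝ≥0∞ :=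
  ⨆ (a : A) (_ : L a ≤ 1), ‖φ a - ψ a‖ₑ

/-- `L` is an `F`-quasi-Leibniz L-seminorm on the unital C*-algebra `A`. The seminorm `L` is
extended by `∞` outside its domain, so that the domain is `{a | L a < ∞}`, which has to be a dense
Jordan–Lie subalgebra of the space of self-adjoint elements. -/
structure IsLSeminorm (F : ℝ≥0∞ → ℝ≥0∞ → ℝ≥0∞ → ℝ≥0∞ → ℝ≥0∞) (L : A → ℝ≥0∞) : Prop where
  isSelfAdjoint : ∀ a, L a < ⊤ → IsSelfAdjoint a
  dense : ∀ a : A, IsSelfAdjoint a → a ∈ closure {b : A | L b < ⊤}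
  add_le : ∀ a b, L a < ⊤ → L b < ⊤ → L (a + b) ≤ L a + L b
  smul_eq : ∀ (t : ℝ) (a : A), L a < ⊤ → L ((t : ℂ) • a) = ‖t‖ₑ * L a
  jordan_mem : ∀ a b, L a < ⊤ → L b < ⊤ → L (jordanProd a b) < ⊤
  lie_mem : ∀ a b, L a < ⊤ → L b < ⊤ → L (lieProd a b) < ⊤
  eq_zero_iff : ∀ a, L a = 0 ↔ ∃ t : ℝ, a = (t : ℂ) • (1 : A)
  /-- The Monge–Kantorovich metric is finite and its balls form neighbourhood bases for the weak*
  topology of the state space. -/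
  kantorovich_lt_top : ∀ φ ∈ stateSpace A, ∀ ψ ∈ stateSpace A, kantorovich L φ ψ < ⊤
  kantorovich_metrizes : ∀ φ : stateSpace A,
    (𝓝 φ).HasBasis (fun r : ℝ≥0∞ => 0 < r) (fun r => {ψ : stateSpace A | kantorovich L φ ψ < r})
  quasiLeibniz : ∀ a b, L a < ⊤ → L b < ⊤ →
    max (L (jordanProd a b)) (L (lieProd a b)) ≤ F ‖a‖ₑ ‖b‖ₑ (L a) (L b)
  lowerSemicontinuous : LowerSemicontinuousOn L {a : A | IsSelfAdjoint a}

end CStar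

/-- An `F`-quasi-Leibniz quantum compact metric space: a unital C*-algebra (with `1 ≠ 0`) and an
L-seminorm. -/
structure QQCMS (F : ℝ≥0∞ → ℝ≥0∞ → ℝ≥0∞ → ℝ≥0∞ → ℝ≥0∞) where
  carrier : Type u
  [cstar : CStarAlgebra carrier]
  [nontriv : Nontrivial carrier]
  L : carrier → ℝ≥0∞
  isLSeminorm : IsLSeminorm F L

attribute [instance] QQCMS.cstar QQCMS.nontriv

section Propinquity

variable {F : ℝ≥0∞ → ℝ≥0∞ → ℝ≥0∞ → ℝ≥0∞ → ℝ≥0∞}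

instance : CoeSort (QQCMS.{u} F) (Type u) := ⟨QQCMS.carrier⟩

/-- Lipschitz linear maps: continuous linear, unital, mapping domain to domain. -/
def IsLipschitzLinear {A B : QQCMS.{u} F} (φ : A →L[ℂ] B) : Prop :=
  φ 1 = 1 ∧ ∀ a : A, A.L a < ⊤ → B.L (φ a) < ⊤

/-- Lipschitz morphisms: unital *-homomorphisms that are Lipschitz linear. -/
def IsLipschitzMorphism {A B : QQCMS.{u} F} (φ : A →L[ℂ] B) : Prop :=
  IsLipschitzLinear φ ∧ (∀ a b : A, φ (a * b) = φ a * φ b) ∧ ∀ a : A, φ (star a) = star (φ a)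

/-- Positive maps; the positive elements of a C*-algebra are those of the form `b⋆ b`. -/
def IsPositiveMap {A B : QQCMS.{u} F} (φ : A →L[ℂ] B) : Prop :=
  ∀ a : A, ∃ b : B, φ (star a * a) = star b * b

/-- The Monge–Kantorovich distance between linear maps. -/
noncomputable def mkDist {A B : QQCMS.{u} F} (φ ψ : A →L[ℂ] B) : ℝ≥0∞ :=
  ⨆ (a : A) (_ : A.L a ≤ 1), ‖φ a - ψ a‖ₑ

/-- Quantum isometries: *-epimorphisms for which the L-seminorm of the codomain is the quotient of
the L-seminorm of the domain (elements that are not self-adjoint have seminorm `∞` and do not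
contribute to the infimum). -/
def IsQuantumIsometry {A B : QQCMS.{u} F} (π : A →⋆ₐ[ℂ] B) : Prop :=
  Function.Surjective π ∧
    ∀ b : B, IsSelfAdjoint b → B.L b = ⨅ (a : A) (_ : π a = b), A.L a

/-- Full quantum isometries. -/
def IsFullQuantumIsometry {A B : QQCMS.{u} F} (h : A ≃⋆ₐ[ℂ] B) : Prop :=
  ∀ a : A, B.L (h a) = A.L a

/-- An `F`-tunnel with domain `A` and codomain `B`. -/
structure Tunnel (A B : QQCMS.{u} F) where
  D : QQCMS.{u} F
  fst : D →⋆ₐ[ℂ] A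
  snd : D →⋆ₐ[ℂ] B
  isometry_fst : IsQuantumIsometry fst
  isometry_snd : IsQuantumIsometry snd

/-- The Hausdorff distance between the subsets `s` and `t` for a distance function `d`. -/
noncomputable def hausdorffFor {X : Type*} (d : X → X → ℝ≥0∞) (s t : Set X) : ℝ≥0∞ :=
  max (⨆ x ∈ s, ⨅ y ∈ t, d x y) (⨆ y ∈ t, ⨅ x ∈ s, d x y)

/-- The image of the state space of `A` under `ψ ↦ ψ ∘ π`. -/
def pullbackStates {D A : QQCMS.{u} F} (π : D →⋆ₐ[ℂ] A) : Set (WeakDual ℂ D) :=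
  {φ | ∃ ψ ∈ stateSpace A, ∀ d : D, φ d = ψ (π d)}

namespace Tunnel

variable {A B : QQCMS.{u} F}

/-- The extent of a tunnel. -/
noncomputable def extent (τ : Tunnel A B) : ℝ≥0∞ :=
  max (hausdorffFor (kantorovich τ.D.L) (stateSpace τ.D) (pullbackStates τ.fst))
    (hausdorffFor (kantorovich τ.D.L) (stateSpace τ.D) (pullbackStates τ.snd))

/-- The inverse tunnel. -/
def inv (τ : Tunnel A B) : Tunnel B A where
  D := τ.D
  fst := τ.snd
  snd := τ.fst
  isometry_fst := τ.isometry_snd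
  isometry_snd := τ.isometry_fst

end Tunnel

theorem isQuantumIsometry_id (A : QQCMS.{u} F) :
    IsQuantumIsometry (A := A) (B := A) (StarAlgHom.id ℂ A) :=
  ⟨fun a => ⟨a, rfl⟩, fun b _ => by simp⟩

theorem IsFullQuantumIsometry.isQuantumIsometry {A B : QQCMS.{u} F} {h : A ≃⋆ₐ[ℂ] B}
    (hh : IsFullQuantumIsometry h) : IsQuantumIsometry (A := A) (B := B) (h : A →⋆ₐ[ℂ] B) := by
  refine ⟨h.surjective, fun b _ => le_antisymm ?_ ?_⟩
  · refine le_iInf₂ fun a ha => ?_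
    have ha' : h a = b := ha
    rw [← ha', hh a]
  · have hb : h (h.symm b) = b := by simp
    have hL : B.L b = A.L (h.symm b) := by rw [← hh (h.symm b), hb]
    rw [hL]
    exact iInf₂_le (f := fun (a : A) (_ : (h : A →⋆ₐ[ℂ] B) a = b) => A.L a) (h.symm b) hb

theorem IsFullQuantumIsometry.symm {A B : QQCMS.{u} F} {h : A ≃⋆ₐ[ℂ] B}
    (hh : IsFullQuantumIsometry h) : IsFullQuantumIsometry (A := B) (B := A) h.symm := by
  intro b
  rw [← hh (h.symm b)]
  simp

/-- The tunnel `(A, id, h)` of a full quantum isometry `h : A → B`. -/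
def Tunnel.ofFull {A B : QQCMS.{u} F} (h : A ≃⋆ₐ[ℂ] B) (hh : IsFullQuantumIsometry h) :
    Tunnel A B where
  D := A
  fst := StarAlgHom.id ℂ A
  snd := (h : A →⋆ₐ[ℂ] B)
  isometry_fst := isQuantumIsometry_id A
  isometry_snd := hh.isQuantumIsometry

/-- The tunnel `(B, h⁻¹, id)` of a full quantum isometry `h : A → B`. -/
def Tunnel.ofFullSymm {A B : QQCMS.{u} F} (h : A ≃⋆ₐ[ℂ] B) (hh : IsFullQuantumIsometry h) :
    Tunnel A B where
  D := B
  fst := (h.symm : B →⋆ₐ[ℂ] A)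
  snd := StarAlgHom.id ℂ B
  isometry_fst := hh.symm.isQuantumIsometry
  isometry_snd := isQuantumIsometry_id B

/-- The class `T` of tunnels is appropriate for the nonempty class `C` of quasi-Leibniz quantum
compact metric spaces. -/
structure IsAppropriate (C : QQCMS.{u} F → Prop) (T : ∀ A B : QQCMS.{u} F, Tunnel A B → Prop) :
    Prop where
  nonempty : ∃ A, C A
  mem_ends : ∀ A B (τ : Tunnel A B), T A B τ → C A ∧ C B
  exists_tunnel : ∀ A B, C A → C B → ∃ τ : Tunnel A B, T A B τ
  inv_mem : ∀ A B (τ : Tunnel A B), T A B τ → T B A τ.inv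
  full_mem : ∀ A B, C A → C B → ∀ (h : A ≃⋆ₐ[ℂ] B) (hh : IsFullQuantumIsometry h),
    T A B (Tunnel.ofFull h hh) ∧ T A B (Tunnel.ofFullSymm h hh)
  exists_comp : ∀ A B E (τ : Tunnel A B) (γ : Tunnel B E), T A B τ → T B E γ →
    ∀ ε : ℝ≥0∞, 0 < ε → ∃ σ : Tunnel A E, T A E σ ∧ σ.extent < τ.extent + γ.extent + ε

/-- The dual propinquity specialized to the class `T` of tunnels. -/
noncomputable def propinquity (T : ∀ A B : QQCMS.{u} F, Tunnel A B → Prop) (A B : QQCMS.{u} F) :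
    ℝ≥0∞ :=
  ⨅ (τ : Tunnel A B) (_ : T A B τ), τ.extent

end Propinquity

/-- The conditions on the map `ς` in a near isometric isomorphism `(ς, κ)`. -/
structure IsNearIsoHalf {G : Type v} {H : Type w} [Monoid G] [MetricSpace G] [Monoid H]
    [MetricSpace H] (ε : ℝ) (ς : G → H) (κ : H → G) : Prop where
  map_mul : ∀ g g' : G, dist (ς g * ς g') (ς (g * g')) ≤ ε
  left_inv : ∀ g : G, dist (κ (ς g)) g ≤ ε
  isometry : ∀ g g' : G, |dist (ς g) (ς g') - dist g g'| ≤ ε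
  map_one : dist (ς 1) 1 ≤ ε

/-- `(ς, κ)` is an `ε`-near isometric isomorphism from `G` to `H`. -/
def IsNearIso {G : Type v} {H : Type w} [Monoid G] [MetricSpace G] [Monoid H]
    [MetricSpace H] (ε : ℝ) (ς : G → H) (κ : H → G) : Prop :=
  IsNearIsoHalf ε ς κ ∧ IsNearIsoHalf ε κ ς

/-! Fix tunnels `τ n` from `An n` to `A` with extents tending to 0, and a nonprincipal ultrafilter
`U` on ℕ, which supplies all limits at once without extracting subsequences. A sequence x_n in `An
n` has limit a (`TunnelLim`) when the x_n lift to elements d_n of the tunnel algebras whose real and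
imaginary parts are bounded in norm and seminorm, and the other projections of the d_n converge to a
along `U`.

Small extents force ‖x_n‖ → ‖a‖: states of a tunnel algebra are close to states pulled back from
either end, which compares norms of self-adjoint elements, and the quasi-Leibniz inequality permits
applying this to d_n* d_n (`TunnelLim.tendsto_norm`). Hence limits are unique; they respect sums,
adjoints and, by quasi-Leibniz again, products. Bounded sequences have limits because Lipschitz
balls of `A` that are bounded in norm are relatively compact (`IsLSeminorm.exists_tendsto`), and
every a of finite seminorm is a limit (`exists_tunnelLim_eq`).

Operators whose norms and Lipschitz constants have convergent bounds preserve bounded sequences, so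
they induce a bounded operator on a dense subspace of `A`, hence on `A` (`exists_isLimitOperator`).
Applied to the operators of κ_n(g), this gives α^g. The maps κ_n fail to be unital and
multiplicative by at most ε_n, an error that K sends to 0, so α is an exact action. Estimates,
positivity and multiplicativity pass to the limit because norms do. -/

/-! ### States of a unital C*-algebra -/

section States

variable {A : Type u} [CStarAlgebra A]

theorem exists_star_mul_self_eq_norm_sub {a : A} (ha : IsSelfAdjoint a) :
    ∃ b : A, ((‖a‖ : ℂ) • (1 : A)) - a = star b * b := by
  let _ := CStarAlgebra.spectralOrder A
  have := CStarAlgebra.spectralOrderedRing A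
  rw [← CStarAlgebra.nonneg_iff_eq_star_mul_self, sub_nonneg]
  have := ha.le_algebraMap_norm_self
  rwa [IsScalarTower.algebraMap_apply ℝ ℂ A, Algebra.algebraMap_eq_smul_one] at this

theorem stateSpace_apply_eq_re {φ : WeakDual ℂ A} (hφ : φ ∈ stateSpace A) {a : A}
    (ha : IsSelfAdjoint a) : φ a = ((φ a).re : ℂ) := by
  obtain ⟨b, hb⟩ := exists_star_mul_self_eq_norm_sub ha
  have h1 := hφ.2 b
  rw [← hb, map_sub, map_smul, hφ.1, Complex.le_def] at h1
  simp only [Complex.zero_im, smul_eq_mul, mul_one, Complex.sub_im, Complex.ofReal_im,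
    zero_sub] at h1
  exact Complex.ext rfl (by simpa using h1.2.symm)

theorem stateSpace_norm_apply_le {φ : WeakDual ℂ A} (hφ : φ ∈ stateSpace A) {a : A}
    (ha : IsSelfAdjoint a) : ‖φ a‖ ≤ ‖a‖ := by
  obtain ⟨b, hb⟩ := exists_star_mul_self_eq_norm_sub ha
  obtain ⟨c, hc⟩ := exists_star_mul_self_eq_norm_sub ha.neg
  have h1 := hφ.2 b
  have h2 := hφ.2 c
  rw [← hb, map_sub, map_smul, hφ.1] at h1
  rw [← hc, map_sub, map_smul, hφ.1, map_neg, norm_neg] at h2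
  rw [Complex.le_def] at h1 h2
  simp at h1 h2
  rw [stateSpace_apply_eq_re hφ ha, Complex.norm_real, Real.norm_eq_abs, abs_le]
  constructor <;> linarith

/-- Splitting into real and imaginary parts costs a factor 2, which is harmless: a bound is only
needed to place the state space in a weak* compact ball. -/
theorem stateSpace_norm_apply_le_two {φ : WeakDual ℂ A} (hφ : φ ∈ stateSpace A) (a : A) :
    ‖φ a‖ ≤ 2 * ‖a‖ := by
  have h := realPart_add_I_smul_imaginaryPart a
  have h1 := stateSpace_norm_apply_le hφ (realPart a).2
  have h2 := stateSpace_norm_apply_le hφ (imaginaryPart a).2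
  have h3 : ‖(realPart a : A)‖ ≤ ‖a‖ := realPart.norm_le a
  have h4 : ‖(imaginaryPart a : A)‖ ≤ ‖a‖ := imaginaryPart.norm_le a
  calc ‖φ a‖ = ‖φ (realPart a : A) + Complex.I • φ (imaginaryPart a : A)‖ := by
        rw [← map_smul, ← map_add, h]
    _ ≤ ‖φ (realPart a : A)‖ + ‖φ (imaginaryPart a : A)‖ :=
        (norm_add_le _ _).trans (by simp)
    _ ≤ 2 * ‖a‖ := by linarith

theorem isCompact_stateSpace : IsCompact (stateSpace A) := by
  refine IsCompact.of_isClosed_subset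
    (WeakDual.isCompact_closedBall (0 : StrongDual ℂ A) 2) ?_ ?_
  · refine IsClosed.inter ?_ ?_
    · exact isClosed_eq (WeakDual.eval_continuous 1) continuous_const
    · have : {φ : WeakDual ℂ A | ∀ a : A, 0 ≤ φ (star a * a)} =
          ⋂ a : A, {φ : WeakDual ℂ A | 0 ≤ φ (star a * a)} := by ext; simp
      change IsClosed {φ : WeakDual ℂ A | ∀ a : A, 0 ≤ φ (star a * a)}
      rw [this]
      exact isClosed_iInter fun a =>
        isClosed_le continuous_const (WeakDual.eval_continuous (star a * a))
  · intro φ hφ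
    simp only [Set.mem_preimage, Metric.mem_closedBall, dist_zero_right]
    exact ContinuousLinearMap.opNorm_le_bound _ (by norm_num)
      fun a => stateSpace_norm_apply_le_two hφ a

/-- Testing on a + it gives |φ(a) + it|² ≤ ‖a‖² + t²; the t² cancel, leaving a bound on a linear
function of the real number t, whose slope must vanish. -/
theorem im_apply_eq_zero_of_norm_le_one {φ : StrongDual ℂ A} (hφ : ‖φ‖ ≤ 1) (h1 : φ 1 = 1)
    {a : A} (ha : IsSelfAdjoint a) : (φ a).im = 0 := by
  have key : ∀ t : ℝ, 2 * t * (φ a).im ≤ ‖a‖ ^ 2 := by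
    intro t
    set z : A := a + ((t : ℂ) * Complex.I) • (1 : A) with hz
    have hstar : star z * z = a * a + ((t ^ 2 : ℝ) : ℂ) • (1 : A) := by
      rw [hz, star_add, star_smul, star_one, ha.star_eq]
      simp only [add_mul, mul_add, smul_mul_assoc, mul_smul_comm, one_mul, mul_one]
      have e1 : star ((t : ℂ) * Complex.I) = -((t : ℂ) * Complex.I) := by simp
      rw [e1]
      have e2 : -((t : ℂ) * Complex.I) * ((t : ℂ) * Complex.I) = ((t ^ 2 : ℝ) : ℂ) := by
        push_cast
        linear_combination (-(t : ℂ) ^ 2) * Complex.I_sq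
      rw [smul_add, smul_smul, mul_comm ((t : ℂ) * Complex.I), e2, neg_smul]
      abel
    have hnorm : ‖z‖ ^ 2 ≤ ‖a‖ ^ 2 + t ^ 2 := by
      rcases subsingleton_or_nontrivial A with hs | hs
      · rw [Subsingleton.elim z 0]; simp; positivity
      rw [sq, ← CStarRing.norm_star_mul_self, hstar]
      refine (norm_add_le _ _).trans ?_
      gcongr
      · rw [sq]; exact norm_mul_le _ _
      · rw [norm_smul, norm_one, mul_one, Complex.norm_real, Real.norm_of_nonneg (by positivity)]
    have hφz : φ z = φ a + (t : ℂ) * Complex.I := by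
      rw [hz, map_add, map_smul, h1]; simp
    have h2 : ‖φ z‖ ^ 2 ≤ ‖z‖ ^ 2 := by
      gcongr
      exact (φ.le_opNorm z).trans (mul_le_of_le_one_left (norm_nonneg _) hφ)
    have h3 : (φ z).im ^ 2 ≤ ‖φ z‖ ^ 2 := by
      rw [← sq_abs]
      gcongr
      exact Complex.abs_im_le_norm _
    have h4 : (φ z).im = (φ a).im + t := by rw [hφz]; simp
    rw [h4] at h3
    nlinarith [sq_nonneg (φ a).im]
  by_contra hne
  -- This t makes the left side of `key` equal to 2(‖a‖² + 1), which is too large.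
  have := key ((‖a‖ ^ 2 + 1) / (φ a).im)
  field_simp at this
  nlinarith [sq_nonneg ‖a‖]

/-- A positive x satisfies ‖‖x‖1 - x‖ ≤ ‖x‖, so ‖x‖ - φ(x) ≤ ‖x‖ once φ is contractive, unital and
real on x. -/
theorem mem_stateSpace_of_norm_le_one {φ : StrongDual ℂ A} (hφ : ‖φ‖ ≤ 1) (h1 : φ 1 = 1) :
    StrongDual.toWeakDual φ ∈ stateSpace A := by
  refine ⟨h1, fun a => ?_⟩
  change 0 ≤ φ (star a * a)
  have hsa := IsSelfAdjoint.star_mul_self a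
  have him := im_apply_eq_zero_of_norm_le_one hφ h1 hsa
  let _ := CStarAlgebra.spectralOrder A
  have := CStarAlgebra.spectralOrderedRing A
  have hsp : SpectrumRestricts (star a * a) ContinuousMap.realToNNReal :=
    SpectrumRestricts.nnreal_of_nonneg (star_mul_self_nonneg a)
  rw [SpectrumRestricts.nnreal_iff_nnnorm hsa le_rfl] at hsp
  have h2 : ‖φ (algebraMap ℝ A ‖star a * a‖ - star a * a)‖ ≤ ‖star a * a‖ :=
    (φ.le_opNorm _).trans ((mul_le_of_le_one_left (norm_nonneg _) hφ).trans hsp)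
  rw [IsScalarTower.algebraMap_apply ℝ ℂ A, Algebra.algebraMap_eq_smul_one, map_sub, map_smul,
    h1] at h2
  have h3 := (Complex.re_le_norm _).trans h2
  simp only [smul_eq_mul, mul_one, Complex.sub_re, Complex.coe_algebraMap, Complex.ofReal_re] at h3
  rw [Complex.le_def]
  exact ⟨by simpa using h3, by simpa using him.symm⟩

/-- The norm of a is the modulus of a spectral value, attained by a character of the C*-algebra
generated by a; a norm-preserving Hahn–Banach extension of it is a state. -/
theorem exists_mem_stateSpace_norm_apply_eq [Nontrivial A] {a : A} (ha : IsSelfAdjoint a) :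
    ∃ φ ∈ stateSpace A, ‖φ a‖ = ‖a‖ := by
  let B := StarAlgebra.elemental ℂ a
  have : IsStarNormal a := ha.isStarNormal
  let b : B := ⟨a, StarAlgebra.elemental.self_mem ℂ a⟩
  have hb : IsSelfAdjoint b := Subtype.ext ha
  obtain ⟨z, hz, hz'⟩ := spectrum.exists_nnnorm_eq_spectralRadius b
  rw [hb.spectralRadius_eq_nnnorm, ENNReal.coe_inj] at hz'
  obtain ⟨f, hf⟩ := WeakDual.CharacterSpace.mem_spectrum_iff_exists.1 hz
  let f' : StrongDual ℂ B.toSubalgebra.toSubmodule := WeakDual.toStrongDual (f : WeakDual ℂ B)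
  have hf' : ‖f'‖ ≤ 1 := by
    refine ContinuousLinearMap.opNorm_le_bound _ zero_le_one fun x => ?_
    rw [one_mul]
    exact AlgHom.norm_apply_le_self (WeakDual.CharacterSpace.toAlgHom f) (⟨x, x.2⟩ : B)
  obtain ⟨φ, hφ, hφn⟩ := exists_extension_norm_eq _ f'
  refine ⟨StrongDual.toWeakDual φ, mem_stateSpace_of_norm_le_one (hφn.trans_le hf') ?_, ?_⟩
  · have := hφ ⟨1, one_mem B⟩
    exact this.trans (map_one (WeakDual.CharacterSpace.toAlgHom f))
  · have := hφ ⟨a, b.2⟩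
    change ‖φ a‖ = ‖a‖
    rw [this]
    change ‖f b‖ = ‖a‖
    rw [hf]
    exact congrArg NNReal.toReal hz'

/-- The norm of a self-adjoint element is bounded by its values on states. -/
theorem norm_le_of_forall_stateSpace [Nontrivial A] {a : A} (ha : IsSelfAdjoint a) {c : ℝ}
    (h : ∀ φ ∈ stateSpace A, ‖φ a‖ ≤ c) : ‖a‖ ≤ c := by
  obtain ⟨φ, hφ, h'⟩ := exists_mem_stateSpace_norm_apply_eq ha
  exact h' ▸ h φ hφ

end States

/-! ### L-seminorms and compactness of Lipschitz balls -/

section LSeminorm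

variable {F : ℝ≥0∞ → ℝ≥0∞ → ℝ≥0∞ → ℝ≥0∞ → ℝ≥0∞} {A : Type u} [CStarAlgebra A] {L : A → ℝ≥0∞}

theorem kantorovich_comm (φ ψ : WeakDual ℂ A) : kantorovich L φ ψ = kantorovich L ψ φ := by
  simp only [kantorovich, ← edist_eq_enorm_sub, edist_comm]

theorem kantorovich_triangle (φ ψ θ : WeakDual ℂ A) :
    kantorovich L φ θ ≤ kantorovich L φ ψ + kantorovich L ψ θ := by
  refine iSup₂_le fun a ha => ?_
  rw [← edist_eq_enorm_sub]
  refine (edist_triangle _ (ψ a) _).trans (add_le_add ?_ ?_) <;> rw [edist_eq_enorm_sub]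
  · exact le_iSup₂ (f := fun a (_ : L a ≤ 1) => ‖φ a - ψ a‖ₑ) a ha
  · exact le_iSup₂ (f := fun a (_ : L a ≤ 1) => ‖ψ a - θ a‖ₑ) a ha

namespace IsLSeminorm

theorem isSelfAdjoint_of_le (hL : IsLSeminorm F L) {a : A} {r : ℝ≥0} (h : L a ≤ r) :
    IsSelfAdjoint a :=
  hL.isSelfAdjoint a (h.trans_lt ENNReal.coe_lt_top)

theorem map_real_smul_one (hL : IsLSeminorm F L) (t : ℝ) : L ((t : ℂ) • (1 : A)) = 0 :=
  (hL.eq_zero_iff _).2 ⟨t, rfl⟩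

theorem map_zero (hL : IsLSeminorm F L) : L 0 = 0 := by
  simpa using hL.map_real_smul_one 0

theorem map_add_le (hL : IsLSeminorm F L) (a b : A) : L (a + b) ≤ L a + L b := by
  by_cases ha : L a < ⊤
  · by_cases hb : L b < ⊤
    · exact hL.add_le a b ha hb
    · rw [not_lt_top_iff.1 hb]; simp
  · rw [not_lt_top_iff.1 ha]; simp

theorem map_real_smul_le (hL : IsLSeminorm F L) (t : ℝ) (a : A) :
    L ((t : ℂ) • a) ≤ ‖t‖ₑ * L a := by
  by_cases ha : L a < ⊤
  · exact (hL.smul_eq t a ha).le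
  · rcases eq_or_ne t 0 with rfl | ht
    · simp [hL.map_zero]
    · rw [not_lt_top_iff.1 ha, ENNReal.mul_top (by simpa using ht)]
      exact le_top

theorem map_neg_le (hL : IsLSeminorm F L) (a : A) : L (-a) ≤ L a := by
  simpa using hL.map_real_smul_le (-1) a

theorem map_sub_le (hL : IsLSeminorm F L) (a b : A) : L (a - b) ≤ L a + L b := by
  rw [sub_eq_add_neg]
  exact (hL.map_add_le _ _).trans (add_le_add le_rfl (hL.map_neg_le b))

theorem map_sub_real_smul_one_le (hL : IsLSeminorm F L) (a : A) (t : ℝ) :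
    L (a - (t : ℂ) • (1 : A)) ≤ L a := by
  refine (hL.map_sub_le a _).trans ?_
  rw [hL.map_real_smul_one, add_zero]

theorem enorm_sub_le (hL : IsLSeminorm F L) (φ ψ : WeakDual ℂ A) {a : A} {l : ℝ≥0} (hl : 0 < l)
    (ha : L a ≤ l) : ‖φ a - ψ a‖ₑ ≤ l * kantorovich L φ ψ := by
  have hl0 : ((l : ℝ) : ℂ) ≠ 0 := by simpa using hl.ne'
  have h1 : L (((l : ℝ)⁻¹ : ℝ) • a) ≤ 1 := by
    have h := hL.map_real_smul_le (l : ℝ)⁻¹ a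
    rw [Complex.coe_smul] at h
    refine h.trans ?_
    have e : ‖((l : ℝ)⁻¹)‖ₑ = (l⁻¹ : ℝ≥0) := by
      rw [← NNReal.coe_inv]
      exact congrArg _ (Real.nnnorm_of_nonneg (l⁻¹).2)
    rw [e]
    calc ((l⁻¹ : ℝ≥0) : ℝ≥0∞) * L a ≤ ((l⁻¹ : ℝ≥0) : ℝ≥0∞) * l := by gcongr
      _ = 1 := by rw [← ENNReal.coe_mul, inv_mul_cancel₀ hl.ne', ENNReal.coe_one]
  rw [← Complex.coe_smul] at h1
  have h2 := le_iSup₂ (f := fun a (_ : L a ≤ 1) => ‖φ a - ψ a‖ₑ) _ h1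
  obtain ⟨b, hb⟩ : ∃ b : A, b = (((l : ℝ)⁻¹ : ℝ) : ℂ) • a := ⟨_, rfl⟩
  rw [← hb] at h1 h2
  have h3 : a = ((l : ℝ) : ℂ) • b := by
    rw [hb, smul_smul, Complex.ofReal_inv, mul_inv_cancel₀ hl0, one_smul]
  have e : ‖((l : ℝ) : ℂ)‖ₑ = l := by
    rw [← ofReal_norm, Complex.norm_real, Real.norm_of_nonneg l.coe_nonneg,
      ENNReal.ofReal_coe_nnreal]
  calc ‖φ a - ψ a‖ₑ = l * ‖φ b - ψ b‖ₑ := by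
        rw [h3, map_smul, map_smul, ← smul_sub, enorm_smul, e]
    _ ≤ l * kantorovich L φ ψ := by gcongr; exact h2

theorem norm_sub_le_of_kantorovich (hL : IsLSeminorm F L) {φ ψ : WeakDual ℂ A} {a : A} {l c : ℝ≥0}
    (hl : 0 < l) (ha : L a ≤ l) (h : kantorovich L φ ψ ≤ c) : ‖φ a - ψ a‖ ≤ l * c := by
  have h1 : ‖φ a - ψ a‖ₑ ≤ ((l * c : ℝ≥0) : ℝ≥0∞) := by
    rw [ENNReal.coe_mul]
    exact (hL.enorm_sub_le φ ψ hl ha).trans (by gcongr)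
  rw [enorm_le_coe] at h1
  exact_mod_cast h1

/-- Metric balls are weak* neighbourhoods, so weak* compactness makes the state space totally
bounded. -/
theorem exists_finite_cover (hL : IsLSeminorm F L) {r : ℝ≥0∞} (hr : 0 < r) :
    ∃ t : Finset (WeakDual ℂ A), (∀ ψ ∈ t, ψ ∈ stateSpace A) ∧
      ∀ φ ∈ stateSpace A, ∃ ψ ∈ t, kantorovich L ψ φ < r := by
  classical
  have : CompactSpace (stateSpace A) := isCompact_iff_compactSpace.1 isCompact_stateSpace
  obtain ⟨t, ht⟩ := CompactSpace.elim_nhds_subcover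
    (fun φ : stateSpace A => {ψ : stateSpace A | kantorovich L φ ψ < r})
    fun φ => (hL.kantorovich_metrizes φ).mem_of_mem hr
  refine ⟨t.image Subtype.val, fun ψ hψ => ?_, fun φ hφ => ?_⟩
  · obtain ⟨ψ', _, rfl⟩ := Finset.mem_image.1 hψ
    exact ψ'.2
  · have hmem : (⟨φ, hφ⟩ : stateSpace A) ∈ (⊤ : Set (stateSpace A)) := trivial
    rw [← ht, Set.mem_iUnion₂] at hmem
    obtain ⟨ψ, hψt, hψ⟩ := hmem
    exact ⟨ψ, Finset.mem_image_of_mem _ hψt, hψ⟩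

/-- Elements with bounded seminorm are within bounded distance of the real scalars. -/
theorem exists_radius [Nontrivial A] (hL : IsLSeminorm F L) :
    ∃ C : ℝ≥0, ∀ (a : A) (l : ℝ≥0), 0 < l → L a ≤ l → ∃ t : ℝ, ‖a - (t : ℂ) • (1 : A)‖ ≤ l * C := by
  obtain ⟨φ₀, hφ₀, -⟩ := exists_mem_stateSpace_norm_apply_eq (IsSelfAdjoint.zero A)
  obtain ⟨t, ht, hcov⟩ := hL.exists_finite_cover one_pos
  -- The sum over the finite 1-net serves as an upper bound for the distances from φ₀ to its points;
  -- the extra 1 reaches every other state.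
  have hfin : ∑ ψ ∈ t, kantorovich L φ₀ ψ + 1 < ⊤ :=
    ENNReal.add_lt_top.2 ⟨ENNReal.sum_lt_top.2 fun ψ hψ =>
      hL.kantorovich_lt_top _ hφ₀ _ (ht ψ hψ), ENNReal.one_lt_top⟩
  refine ⟨(∑ ψ ∈ t, kantorovich L φ₀ ψ + 1).toNNReal, fun a l hl ha => ⟨(φ₀ a).re, ?_⟩⟩
  have hsa := hL.isSelfAdjoint_of_le ha
  rw [← stateSpace_apply_eq_re hφ₀ hsa]
  have hsa' : IsSelfAdjoint (a - φ₀ a • (1 : A)) := by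
    rw [stateSpace_apply_eq_re hφ₀ hsa]
    refine hsa.sub (IsSelfAdjoint.smul ?_ (IsSelfAdjoint.one A))
    exact Complex.conj_ofReal _
  refine norm_le_of_forall_stateSpace hsa' fun φ hφ => ?_
  rw [map_sub, map_smul, hφ.1, smul_eq_mul, mul_one]
  refine hL.norm_sub_le_of_kantorovich hl ha ?_
  rw [ENNReal.coe_toNNReal hfin.ne]
  obtain ⟨ψ, hψt, hψ⟩ := hcov φ hφ
  rw [kantorovich_comm]
  refine (kantorovich_triangle φ₀ ψ φ).trans (add_le_add ?_ hψ.le)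
  exact Finset.single_le_sum (f := fun ψ => kantorovich L φ₀ ψ) (fun _ _ => zero_le) hψt

theorem le_of_tendsto (hL : IsLSeminorm F L) {ι : Type*} {U : Filter ι} [U.NeBot] {f : ι → A}
    {a : A} {c : ℝ≥0} (hf : ∀ᶠ i in U, L (f i) ≤ c) (h : Tendsto f U (𝓝 a)) :
    L a ≤ c := by
  have hsa : IsSelfAdjoint a :=
    (isClosed_eq continuous_star continuous_id).mem_of_tendsto h
      (hf.mono fun i hi => hL.isSelfAdjoint_of_le hi)
  by_contra hlt
  have hev := hL.lowerSemicontinuous a hsa c (not_le.1 hlt)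
  have hf' : Tendsto f U (𝓝[{a : A | IsSelfAdjoint a}] a) :=
    tendsto_nhdsWithin_iff.2 ⟨h, hf.mono fun i hi => hL.isSelfAdjoint_of_le hi⟩
  obtain ⟨i, hi, hi'⟩ := (hf.and (hf'.eventually hev)).exists
  exact absurd hi (not_le.2 hi')

/-- Sets of bounded elements with bounded seminorm are relatively compact. -/
theorem exists_tendsto [Nontrivial A] (hL : IsLSeminorm F L) {ι : Type*} (U : Ultrafilter ι)
    {f : ι → A} {l : ℝ≥0} {M : ℝ} (hf : ∀ᶠ i in U, L (f i) ≤ l) (hM : ∀ᶠ i in U, ‖f i‖ ≤ M) :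
    ∃ a, Tendsto f U (𝓝 a) := by
  -- An Arzelà–Ascoli argument: the values at a finite net of states converge along `U`, and the
  -- seminorm bound controls all other states. Two moves to the net and two to the limits cost ε/8
  -- each, ε/2 in total.
  suffices h : Cauchy (map f (U : Filter ι)) from CompleteSpace.complete h
  rw [Metric.cauchy_iff]
  refine ⟨inferInstance, fun ε hε => ?_⟩
  -- Adding 1 keeps the denominator of `r` nonzero when l = 0.
  set l' : ℝ≥0 := l + 1 with hl'
  have hl'pos : 0 < l' := by positivity
  let ε' : ℝ≥0 := ⟨ε, hε.le⟩
  set r : ℝ≥0 := ε' / (8 * l') with hr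
  have hrpos : 0 < r := div_pos hε (by positivity)
  obtain ⟨t, ht, hcov⟩ := hL.exists_finite_cover (ENNReal.coe_pos.2 hrpos)
  have hlim : ∀ ψ ∈ t, ∃ z : ℂ, Tendsto (fun i => ψ (f i)) U (𝓝 z) := by
    intro ψ hψ
    obtain ⟨z, -, hz⟩ := (isCompact_closedBall (0 : ℂ) M).ultrafilter_le_nhds
      (U.map fun i => ψ (f i)) (by
        rw [le_principal_iff]
        change ∀ᶠ i in (U : Filter ι), ψ (f i) ∈ Metric.closedBall 0 M
        filter_upwards [hf, hM] with i hi hi'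
        simpa using (stateSpace_norm_apply_le (ht ψ hψ) (hL.isSelfAdjoint_of_le hi)).trans hi')
    exact ⟨z, hz⟩
  choose! z hz using hlim
  have hev : ∀ᶠ i in U, ∀ ψ ∈ t, dist (ψ (f i)) (z ψ) < ε / 8 :=
    (Filter.eventually_all_finset t).2 fun ψ hψ =>
      (hz ψ hψ).eventually (Metric.ball_mem_nhds _ (by positivity))
  refine ⟨f '' {i | L (f i) ≤ l ∧ ∀ ψ ∈ t, dist (ψ (f i)) (z ψ) < ε / 8},
    image_mem_map (hf.and hev), ?_⟩
  rintro _ ⟨i, ⟨hi, hi'⟩, rfl⟩ _ ⟨j, ⟨hj, hj'⟩, rfl⟩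
  have hsa := (hL.isSelfAdjoint_of_le hi).sub (hL.isSelfAdjoint_of_le hj)
  have hll : (l : ℝ≥0∞) ≤ l' := by rw [hl']; exact_mod_cast le_self_add
  have hlr : (l' : ℝ) * r = ε / 8 := by
    rw [hr]
    have : (l' : ℝ) ≠ 0 := by exact_mod_cast hl'pos.ne'
    push_cast
    field_simp
    rfl
  refine lt_of_le_of_lt ?_ (half_lt_self hε)
  rw [dist_eq_norm]
  refine norm_le_of_forall_stateSpace hsa fun φ hφ => ?_
  obtain ⟨ψ, hψt, hψ⟩ := hcov φ hφ
  have h1 := hL.norm_sub_le_of_kantorovich hl'pos (hi.trans hll) hψ.le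
  have h2 := hL.norm_sub_le_of_kantorovich hl'pos (hj.trans hll) hψ.le
  have h3 := (hi' ψ hψt).le
  have h4 := (hj' ψ hψt).le
  rw [← dist_eq_norm, hlr] at h1 h2
  rw [map_sub, ← dist_eq_norm]
  rw [dist_comm] at h1 h4
  have h5 := dist_triangle4 (φ (f i)) (ψ (f i)) (z ψ) (ψ (f j))
  have h6 := dist_triangle (φ (f i)) (ψ (f j)) (φ (f j))
  linarith

end IsLSeminorm

end LSeminorm

/-! ### Complex elements with Lipschitz real and imaginary parts -/

section LipBounded

/-- `z = x + i y` where `x` and `y` have norm and seminorm at most `r`. -/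
def LipBounded {A : Type u} [CStarAlgebra A] (L : A → ℝ≥0∞) (r : ℝ≥0) (z : A) : Prop :=
  ∃ x y : A, L x ≤ r ∧ L y ≤ r ∧ ‖x‖ ≤ r ∧ ‖y‖ ≤ r ∧ z = x + Complex.I • y

variable {F : ℝ≥0∞ → ℝ≥0∞ → ℝ≥0∞ → ℝ≥0∞ → ℝ≥0∞} {A : Type u} [CStarAlgebra A] {L : A → ℝ≥0∞}

theorem norm_jordanProd_le (a b : A) : ‖jordanProd a b‖ ≤ ‖a‖ * ‖b‖ := by
  have := norm_add_le (a * b) (b * a)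
  have h1 := norm_mul_le a b
  have h2 := norm_mul_le b a
  rw [jordanProd, norm_smul]
  simp only [one_div, norm_inv, Complex.norm_ofNat]
  linarith

theorem norm_lieProd_le (a b : A) : ‖lieProd a b‖ ≤ ‖a‖ * ‖b‖ := by
  have := norm_sub_le (a * b) (b * a)
  have h1 := norm_mul_le a b
  have h2 := norm_mul_le b a
  rw [lieProd, norm_smul]
  simp only [one_div, norm_inv, norm_mul, Complex.norm_ofNat, Complex.norm_I, mul_one]
  linarith

theorem mul_eq_jordanProd_add_lieProd (a b : A) :
    a * b = jordanProd a b + Complex.I • lieProd a b := by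
  have hI : Complex.I * (1 / (2 * Complex.I)) = (1 / 2 : ℂ) := by
    field_simp
  rw [jordanProd, lieProd, smul_smul, hI, ← smul_add]
  rw [add_add_sub_cancel, ← two_smul ℂ, smul_smul]
  norm_num

namespace LipBounded

theorem mono {r s : ℝ≥0} (hrs : r ≤ s) {z : A} (h : LipBounded L r z) : LipBounded L s z := by
  obtain ⟨x, y, h1, h2, h3, h4, h5⟩ := h
  have e : (r : ℝ≥0∞) ≤ s := by exact_mod_cast hrs
  have e' : (r : ℝ) ≤ s := by exact_mod_cast hrs
  exact ⟨x, y, h1.trans e, h2.trans e, h3.trans e', h4.trans e', h5⟩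

theorem of_isSelfAdjoint (hL : IsLSeminorm F L) {r : ℝ≥0} {x : A} (h : L x ≤ r) (h' : ‖x‖ ≤ r) :
    LipBounded L r x :=
  ⟨x, 0, h, by simp [hL.map_zero], h', by simp, by simp⟩

/-- The imaginary part must vanish. Applied to d* d, this turns a bound on a product into a bound on
its seminorm. -/
theorem le_of_isSelfAdjoint (hL : IsLSeminorm F L) {r : ℝ≥0} {z : A} (h : LipBounded L r z)
    (hz : IsSelfAdjoint z) : L z ≤ r := by
  obtain ⟨x, y, h1, h2, h3, h4, rfl⟩ := h
  have hx := hL.isSelfAdjoint_of_le h1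
  have hy := hL.isSelfAdjoint_of_le h2
  have h5 := hz.star_eq
  rw [star_add, star_smul, hx.star_eq, hy.star_eq, add_right_inj] at h5
  have h6 : (2 * Complex.I) • y = 0 := by
    have : star Complex.I = -Complex.I := by simp
    rw [this, neg_smul, neg_eq_iff_add_eq_zero, ← two_smul ℂ, smul_smul] at h5
    exact h5
  have h7 : y = 0 := (smul_eq_zero.1 h6).resolve_left (by simp)
  simpa [h7] using h1

theorem add (hL : IsLSeminorm F L) {r s : ℝ≥0} {z w : A} (hz : LipBounded L r z)
    (hw : LipBounded L s w) : LipBounded L (r + s) (z + w) := by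
  obtain ⟨x, y, h1, h2, h3, h4, rfl⟩ := hz
  obtain ⟨u, v, k1, k2, k3, k4, rfl⟩ := hw
  refine ⟨x + u, y + v, ?_, ?_, ?_, ?_, by rw [smul_add]; abel⟩
  · push_cast; exact (hL.map_add_le _ _).trans (add_le_add h1 k1)
  · push_cast; exact (hL.map_add_le _ _).trans (add_le_add h2 k2)
  · push_cast; exact (norm_add_le _ _).trans (add_le_add h3 k3)
  · push_cast; exact (norm_add_le _ _).trans (add_le_add h4 k4)

theorem star (hL : IsLSeminorm F L) {r : ℝ≥0} {z : A} (hz : LipBounded L r z) :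
    LipBounded L r (star z) := by
  obtain ⟨x, y, h1, h2, h3, h4, rfl⟩ := hz
  refine ⟨x, -y, h1, (hL.map_neg_le y).trans h2, h3, by rwa [norm_neg], ?_⟩
  rw [star_add, star_smul, (hL.isSelfAdjoint_of_le h1).star_eq,
    (hL.isSelfAdjoint_of_le h2).star_eq]
  simp

theorem smul_one [Nontrivial A] (hL : IsLSeminorm F L) (c : ℂ) :
    LipBounded L ‖c‖₊ (c • (1 : A)) := by
  refine ⟨(c.re : ℂ) • 1, (c.im : ℂ) • 1, ?_, ?_, ?_, ?_, ?_⟩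
  · rw [hL.map_real_smul_one]; exact zero_le
  · rw [hL.map_real_smul_one]; exact zero_le
  · rw [norm_smul, norm_one, mul_one, Complex.norm_real]; exact Complex.abs_re_le_norm c
  · rw [norm_smul, norm_one, mul_one, Complex.norm_real]; exact Complex.abs_im_le_norm c
  · rw [smul_smul, ← add_smul, mul_comm, Complex.re_add_im]

end LipBounded

theorem IsLSeminorm.jordanProd_le (hF : IsAdmissible F)
    (hF_fin : ∀ x y lx ly : ℝ≥0, F x y lx ly < ⊤) (hL : IsLSeminorm F L) {r : ℝ≥0} {a b : A}
    (ha : L a ≤ r) (hb : L b ≤ r) (ha' : ‖a‖ ≤ r) (hb' : ‖b‖ ≤ r) :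
    L (jordanProd a b) ≤ (F r r r r).toNNReal ∧ L (lieProd a b) ≤ (F r r r r).toNNReal := by
  rw [ENNReal.coe_toNNReal (hF_fin r r r r).ne, ← max_le_iff]
  refine (hL.quasiLeibniz a b (ha.trans_lt ENNReal.coe_lt_top)
    (hb.trans_lt ENNReal.coe_lt_top)).trans (hF.mono ?_ ?_ ha hb)
  · exact enorm_le_coe.2 ha'
  · exact enorm_le_coe.2 hb'

/-- The bound on products given by the quasi-Leibniz inequality. -/
noncomputable def mulBound (F : ℝ≥0∞ → ℝ≥0∞ → ℝ≥0∞ → ℝ≥0∞ → ℝ≥0∞) (r : ℝ≥0) : ℝ≥0 :=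
  4 * ((F r r r r).toNNReal + r * r)

theorem LipBounded.mul (hF : IsAdmissible F)
    (hF_fin : ∀ x y lx ly : ℝ≥0, F x y lx ly < ⊤) (hL : IsLSeminorm F L) {r : ℝ≥0} {z w : A}
    (hz : LipBounded L r z) (hw : LipBounded L r w) : LipBounded L (mulBound F r) (z * w) := by
  obtain ⟨x, y, h1, h2, h3, h4, rfl⟩ := hz
  obtain ⟨u, v, k1, k2, k3, k4, rfl⟩ := hw
  set q : ℝ≥0 := (F r r r r).toNNReal
  have bound : ∀ p₁ p₂ p₃ p₄ : A, L p₁ ≤ q → L p₂ ≤ q → L p₃ ≤ q → L p₄ ≤ q →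
      L (p₁ - p₂ - p₃ - p₄) ≤ (mulBound F r : ℝ≥0) ∧
        L (p₁ - p₂ + p₃ + p₄) ≤ (mulBound F r : ℝ≥0) := by
    intro p₁ p₂ p₃ p₄ e1 e2 e3 e4
    have hq : (q + q + q + q : ℝ≥0∞) ≤ (mulBound F r : ℝ≥0) := by
      norm_cast
      rw [mulBound]
      calc q + q + q + q = 4 * q := by ring
        _ ≤ 4 * (q + r * r) := by gcongr; exact le_self_add
    constructor
    · refine le_trans ?_ hq
      refine (hL.map_sub_le _ _).trans (add_le_add ?_ e4)
      refine (hL.map_sub_le _ _).trans (add_le_add ?_ e3)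
      exact (hL.map_sub_le _ _).trans (add_le_add e1 e2)
    · refine le_trans ?_ hq
      refine (hL.map_add_le _ _).trans (add_le_add ?_ e4)
      refine (hL.map_add_le _ _).trans (add_le_add ?_ e3)
      exact (hL.map_sub_le _ _).trans (add_le_add e1 e2)
  have bound' : ∀ p₁ p₂ p₃ p₄ : A, ‖p₁‖ ≤ r * r → ‖p₂‖ ≤ r * r → ‖p₃‖ ≤ r * r → ‖p₄‖ ≤ r * r →
      ‖p₁ - p₂ - p₃ - p₄‖ ≤ mulBound F r ∧ ‖p₁ - p₂ + p₃ + p₄‖ ≤ mulBound F r := by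
    intro p₁ p₂ p₃ p₄ e1 e2 e3 e4
    have hq : (r * r + r * r + r * r + r * r : ℝ) ≤ mulBound F r := by
      rw [mulBound]
      have : (0 : ℝ) ≤ q := q.2
      rw [NNReal.coe_mul, NNReal.coe_add, NNReal.coe_mul, NNReal.coe_ofNat]
      linarith
    have n1 := norm_sub_le p₁ p₂
    have n2 := norm_sub_le (p₁ - p₂) p₃
    have n3 := norm_sub_le (p₁ - p₂ - p₃) p₄
    have n4 := norm_add_le (p₁ - p₂) p₃
    have n5 := norm_add_le (p₁ - p₂ + p₃) p₄
    constructor <;> linarith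
  have hJ : ∀ {a b : A}, ‖a‖ ≤ r → ‖b‖ ≤ r → ‖jordanProd a b‖ ≤ r * r := fun ha hb =>
    (norm_jordanProd_le _ _).trans (mul_le_mul ha hb (norm_nonneg _) r.2)
  have hLi : ∀ {a b : A}, ‖a‖ ≤ r → ‖b‖ ≤ r → ‖lieProd a b‖ ≤ r * r := fun ha hb =>
    (norm_lieProd_le _ _).trans (mul_le_mul ha hb (norm_nonneg _) r.2)
  have xu := hL.jordanProd_le hF hF_fin h1 k1 h3 k3
  have xv := hL.jordanProd_le hF hF_fin h1 k2 h3 k4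
  have yu := hL.jordanProd_le hF hF_fin h2 k1 h4 k3
  have yv := hL.jordanProd_le hF hF_fin h2 k2 h4 k4
  -- Expanding (x + iy)(u + iv) with ab = a∘b + i{a,b} gives four Jordan or Lie products in each
  -- part, whence the factor 4 in `mulBound`.
  refine ⟨jordanProd x u - jordanProd y v - lieProd x v - lieProd y u,
    lieProd x u - lieProd y v + jordanProd x v + jordanProd y u,
    (bound _ _ _ _ xu.1 yv.1 xv.2 yu.2).1, (bound _ _ _ _ xu.2 yv.2 xv.1 yu.1).2,
    (bound' _ _ _ _ (hJ h3 k3) (hJ h4 k4) (hLi h3 k4) (hLi h4 k3)).1,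
    (bound' _ _ _ _ (hLi h3 k3) (hLi h4 k4) (hJ h3 k4) (hJ h4 k3)).2, ?_⟩
  have hII : ∀ a : A, Complex.I • Complex.I • a = -a := fun a => by
    rw [smul_smul, Complex.I_mul_I, neg_one_smul]
  simp only [add_mul, mul_add, smul_mul_assoc, mul_smul_comm]
  rw [mul_eq_jordanProd_add_lieProd x u, mul_eq_jordanProd_add_lieProd x v,
    mul_eq_jordanProd_add_lieProd y u, mul_eq_jordanProd_add_lieProd y v]
  simp only [smul_add, smul_sub, hII, smul_neg]
  abel

end LipBounded

/-! ### Quantum isometries and norms -/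

section Isometry

variable {F : ℝ≥0∞ → ℝ≥0∞ → ℝ≥0∞ → ℝ≥0∞ → ℝ≥0∞} {D A : QQCMS.{u} F} {π : D →⋆ₐ[ℂ] A}

theorem IsQuantumIsometry.map_le (hπ : IsQuantumIsometry π) (d : D) : A.L (π d) ≤ D.L d := by
  by_cases hd : D.L d < ⊤
  · rw [hπ.2 (π d) ((D.isLSeminorm.isSelfAdjoint d hd).map π)]
    exact iInf₂_le (f := fun (a : D) (_ : π a = π d) => D.L a) d rfl
  · rw [not_lt_top_iff.1 hd]; exact le_top

theorem IsQuantumIsometry.exists_lift (hπ : IsQuantumIsometry π) {a : A} {l : ℝ≥0∞}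
    (ha : A.L a < l) : ∃ d : D, π d = a ∧ D.L d < l := by
  rw [hπ.2 a (A.isLSeminorm.isSelfAdjoint a (ha.trans_le le_top))] at ha
  simpa [iInf_lt_iff] using ha

theorem starAlgHom_norm_apply_le (π : D →⋆ₐ[ℂ] A) (d : D) : ‖π d‖ ≤ ‖d‖ :=
  NonUnitalStarAlgHom.norm_apply_le π d

theorem IsQuantumIsometry.lipBounded (hπ : IsQuantumIsometry π) {r : ℝ≥0} {d : D}
    (hd : LipBounded D.L r d) : LipBounded A.L r (π d) := by
  obtain ⟨x, y, h1, h2, h3, h4, rfl⟩ := hd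
  exact ⟨π x, π y, (hπ.map_le x).trans h1, (hπ.map_le y).trans h2,
    (starAlgHom_norm_apply_le π x).trans h3, (starAlgHom_norm_apply_le π y).trans h4, by simp⟩

/-- Each state of D lies within c of some θ ∘ π, and |θ(π d)| ≤ ‖π d‖; the seminorm bound makes the
replacement cost at most l c. -/
theorem norm_le_of_hausdorffFor_lt {c l : ℝ≥0} (hl : 0 < l)
    (hc : hausdorffFor (kantorovich D.L) (stateSpace D) (pullbackStates π) < c) {d : D}
    (hd : D.L d ≤ l) : ‖d‖ ≤ ‖π d‖ + l * c := by
  have hsa := D.isLSeminorm.isSelfAdjoint_of_le hd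
  refine norm_le_of_forall_stateSpace hsa fun φ hφ => ?_
  have h1 : ⨅ ψ ∈ pullbackStates π, kantorovich D.L φ ψ < c :=
    (le_iSup₂ (f := fun φ (_ : φ ∈ stateSpace D) =>
      ⨅ ψ ∈ pullbackStates π, kantorovich D.L φ ψ) φ hφ).trans_lt ((le_max_left _ _).trans_lt hc)
  simp only [iInf_lt_iff] at h1
  obtain ⟨ψ, ⟨θ, hθ, hθ'⟩, hψ⟩ := h1
  have h2 := D.isLSeminorm.norm_sub_le_of_kantorovich hl hd hψ.le
  have h3 : ‖ψ d‖ ≤ ‖π d‖ := by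
    rw [hθ' d]
    exact stateSpace_norm_apply_le hθ (hsa.map π)
  have h4 := norm_le_norm_add_norm_sub' (φ d) (ψ d)
  linarith

end Isometry

/-! ### Comparing norms across a tunnel -/

section Tunnel

variable {F : ℝ≥0∞ → ℝ≥0∞ → ℝ≥0∞ → ℝ≥0∞ → ℝ≥0∞} {A B : QQCMS.{u} F}

theorem Tunnel.norm_le_fst (τ : Tunnel A B) {c l : ℝ≥0} (hl : 0 < l) (hc : τ.extent < c)
    {d : τ.D} (hd : τ.D.L d ≤ l) : ‖d‖ ≤ ‖τ.fst d‖ + l * c :=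
  norm_le_of_hausdorffFor_lt hl ((le_max_left _ _).trans_lt hc) hd

theorem Tunnel.norm_le_snd (τ : Tunnel A B) {c l : ℝ≥0} (hl : 0 < l) (hc : τ.extent < c)
    {d : τ.D} (hd : τ.D.L d ≤ l) : ‖d‖ ≤ ‖τ.snd d‖ + l * c :=
  norm_le_of_hausdorffFor_lt hl ((le_max_right _ _).trans_lt hc) hd

/-- States only control self-adjoint elements, so the comparison is made for d* d and read off by
the C*-identity. The added 1 makes the seminorm bound positive. -/
theorem Tunnel.sq_norm_sub_le (hF : IsAdmissible F)
    (hF_fin : ∀ x y lx ly : ℝ≥0, F x y lx ly < ⊤) (τ : Tunnel A B) {c r : ℝ≥0}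
    (hc : τ.extent < c) {d : τ.D} (hd : LipBounded τ.D.L r d) :
    |‖τ.fst d‖ ^ 2 - ‖τ.snd d‖ ^ 2| ≤ (mulBound F r + 1 : ℝ≥0) * c := by
  have h1 : τ.D.L (star d * d) ≤ (mulBound F r + 1 : ℝ≥0) :=
    (((hd.star τ.D.isLSeminorm).mul hF hF_fin τ.D.isLSeminorm hd).le_of_isSelfAdjoint
      τ.D.isLSeminorm (IsSelfAdjoint.star_mul_self d)).trans (by exact_mod_cast le_self_add)
  have hpos : 0 < mulBound F r + 1 := by positivity
  have h2 := τ.norm_le_fst hpos hc h1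
  have h3 := τ.norm_le_snd hpos hc h1
  rw [map_mul, map_star, CStarRing.norm_star_mul_self, CStarRing.norm_star_mul_self] at h2 h3
  have h4 := starAlgHom_norm_apply_le τ.fst d
  have h5 := starAlgHom_norm_apply_le τ.snd d
  have h6 := norm_nonneg (τ.fst d)
  have h7 := norm_nonneg (τ.snd d)
  rw [abs_le]
  constructor <;> nlinarith

end Tunnel

/-! ### Limits of sequences through tunnels -/

section TunnelLimit

variable {F : ℝ≥0∞ → ℝ≥0∞ → ℝ≥0∞ → ℝ≥0∞ → ℝ≥0∞} {An : ℕ → QQCMS.{u} F} {A : QQCMS.{u} F}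

/-- `a` is the limit along `U` of the sequence `x`, seen through the tunnels `τ n`. -/
def TunnelLim (τ : ∀ n, Tunnel (An n) A) (U : Ultrafilter ℕ) (x : ∀ n, An n) (a : A) : Prop :=
  ∃ (r : ℝ≥0) (d : ∀ n, (τ n).D),
    (∀ᶠ n in U, LipBounded (τ n).D.L r (d n) ∧ (τ n).fst (d n) = x n) ∧
      Tendsto (fun n => (τ n).snd (d n)) U (𝓝 a)

variable {τ : ∀ n, Tunnel (An n) A} {U : Ultrafilter ℕ}

namespace TunnelLim

variable {x y : ∀ n, An n} {a b : A}

theorem add (hx : TunnelLim τ U x a) (hy : TunnelLim τ U y b) :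
    TunnelLim τ U (fun n => x n + y n) (a + b) := by
  obtain ⟨r, d, hd, hd'⟩ := hx
  obtain ⟨s, e, he, he'⟩ := hy
  refine ⟨r + s, fun n => d n + e n, ?_, by simpa using hd'.add he'⟩
  filter_upwards [hd, he] with n h1 h2
  exact ⟨h1.1.add (τ n).D.isLSeminorm h2.1, by rw [map_add, h1.2, h2.2]⟩

theorem star (hx : TunnelLim τ U x a) : TunnelLim τ U (fun n => star (x n)) (star a) := by
  obtain ⟨r, d, hd, hd'⟩ := hx
  refine ⟨r, fun n => Star.star (d n), ?_, hd'.star.congr fun n => (map_star _ _).symm⟩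
  filter_upwards [hd] with n h1
  exact ⟨h1.1.star (τ n).D.isLSeminorm, by rw [map_star, h1.2]⟩

theorem smul_one (c : ℂ) : TunnelLim τ U (fun n => c • (1 : An n)) (c • (1 : A)) :=
  ⟨‖c‖₊, fun n => c • (1 : (τ n).D),
    Eventually.of_forall fun n => ⟨LipBounded.smul_one (τ n).D.isLSeminorm c, by simp⟩,
    by simp⟩

theorem one : TunnelLim τ U (fun n => (1 : An n)) (1 : A) := by
  simpa using smul_one (τ := τ) (U := U) 1

theorem mul (hF : IsAdmissible F) (hF_fin : ∀ x y lx ly : ℝ≥0, F x y lx ly < ⊤)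
    (hx : TunnelLim τ U x a) (hy : TunnelLim τ U y b) :
    TunnelLim τ U (fun n => x n * y n) (a * b) := by
  obtain ⟨r, d, hd, hd'⟩ := hx
  obtain ⟨s, e, he, he'⟩ := hy
  refine ⟨mulBound F (max r s), fun n => d n * e n, ?_, by simpa using hd'.mul he'⟩
  filter_upwards [hd, he] with n h1 h2
  exact ⟨(h1.1.mono (le_max_left _ _)).mul hF hF_fin (τ n).D.isLSeminorm
    (h2.1.mono (le_max_right _ _)), by rw [map_mul, h1.2, h2.2]⟩

/-- A complex scalar mixes real and imaginary parts, so it is treated as multiplication by c1. -/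
theorem smul (hF : IsAdmissible F) (hF_fin : ∀ x y lx ly : ℝ≥0, F x y lx ly < ⊤) (c : ℂ)
    (hx : TunnelLim τ U x a) : TunnelLim τ U (fun n => c • x n) (c • a) := by
  simpa using (smul_one c).mul hF hF_fin hx

theorem sub (hF : IsAdmissible F) (hF_fin : ∀ x y lx ly : ℝ≥0, F x y lx ly < ⊤)
    (hx : TunnelLim τ U x a) (hy : TunnelLim τ U y b) :
    TunnelLim τ U (fun n => x n - y n) (a - b) := by
  simpa [sub_eq_add_neg] using hx.add (hy.smul hF hF_fin (-1))

theorem exists_lipBounded (hx : TunnelLim τ U x a) :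
    ∃ r : ℝ≥0, ∀ᶠ n in U, LipBounded (An n).L r (x n) := by
  obtain ⟨r, d, hd, -⟩ := hx
  refine ⟨r, hd.mono fun n h => ?_⟩
  rw [← h.2]
  exact (τ n).isometry_fst.lipBounded h.1

theorem tendsto_norm (hF : IsAdmissible F) (hF_fin : ∀ x y lx ly : ℝ≥0, F x y lx ly < ⊤)
    (hτ : Tendsto (fun n => (τ n).extent) U (𝓝 0)) (hx : TunnelLim τ U x a) :
    Tendsto (fun n => ‖x n‖) U (𝓝 ‖a‖) := by
  obtain ⟨r, d, hd, hd'⟩ := hx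
  have h1 : Tendsto (fun n => ‖x n‖ ^ 2 - ‖(τ n).snd (d n)‖ ^ 2) U (𝓝 0) := by
    rw [Metric.tendsto_nhds]
    intro ε hε
    set m : ℝ≥0 := mulBound F r + 1 with hm
    have hmpos : 0 < m := by positivity
    let ε' : ℝ≥0 := ⟨ε, hε.le⟩
    have hc : 0 < ε' / (2 * m) := div_pos hε (by positivity)
    have hτ' : ∀ᶠ n in U, (τ n).extent < ((ε' / (2 * m) : ℝ≥0) : ℝ≥0∞) :=
      hτ.eventually (gt_mem_nhds (ENNReal.coe_pos.2 hc))
    filter_upwards [hd, hτ'] with n h1 h2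
    have h3 := (τ n).sq_norm_sub_le hF hF_fin h2 h1.1
    rw [h1.2, ← hm] at h3
    rw [Real.dist_eq, sub_zero]
    refine h3.trans_lt ?_
    have : (m : ℝ) ≠ 0 := by exact_mod_cast hmpos.ne'
    push_cast
    change (m : ℝ) * (ε / (2 * m)) < ε
    field_simp
    linarith
  have h2 := (h1.add (hd'.norm.pow 2)).sqrt
  simpa [Real.sqrt_sq] using h2

theorem eq_of_tendsto (hF : IsAdmissible F) (hF_fin : ∀ x y lx ly : ℝ≥0, F x y lx ly < ⊤)
    (hτ : Tendsto (fun n => (τ n).extent) U (𝓝 0)) (hx : TunnelLim τ U x a)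
    (hy : TunnelLim τ U y b) (h : Tendsto (fun n => ‖x n - y n‖) U (𝓝 0)) : a = b := by
  have := tendsto_nhds_unique ((hx.sub hF hF_fin hy).tendsto_norm hF hF_fin hτ) h
  exact sub_eq_zero.1 (norm_eq_zero.1 this)

theorem unique (hF : IsAdmissible F) (hF_fin : ∀ x y lx ly : ℝ≥0, F x y lx ly < ⊤)
    (hτ : Tendsto (fun n => (τ n).extent) U (𝓝 0)) (hx : TunnelLim τ U x a)
    (hy : TunnelLim τ U x b) : a = b :=
  hx.eq_of_tendsto hF hF_fin hτ hy (by simp)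

end TunnelLim

/-- The lifts have bounded norm since the extents are eventually below 1, so their images in A have
a limit by compactness. The slack l < l' is there because the infimum defining a quotient seminorm
need not be attained. -/
theorem exists_tunnelLim_of_le (hτ : Tendsto (fun n => (τ n).extent) U (𝓝 0)) {x : ∀ n, An n}
    {l l' r : ℝ≥0} (hl : l < l') (hx : ∀ᶠ n in U, (An n).L (x n) ≤ l)
    (hr : ∀ᶠ n in U, ‖x n‖ ≤ r) : ∃ a : A, TunnelLim τ U x a ∧ A.L a ≤ l' := by
  have hl' : 0 < l' := (zero_le).trans_lt hl
  have hlift : ∀ n, ∃ d : (τ n).D, (An n).L (x n) ≤ l →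
      (τ n).fst d = x n ∧ (τ n).D.L d < l' := by
    intro n
    by_cases h : (An n).L (x n) ≤ l
    · obtain ⟨d, hd⟩ := (τ n).isometry_fst.exists_lift (h.trans_lt (ENNReal.coe_lt_coe.2 hl))
      exact ⟨d, fun _ => hd⟩
    · exact ⟨0, fun h' => absurd h' h⟩
  choose d hd using hlift
  have h1 : ∀ᶠ n in U, (τ n).extent < ((1 : ℝ≥0) : ℝ≥0∞) :=
    hτ.eventually (gt_mem_nhds (by simp))
  have hd' : ∀ᶠ n in U, (τ n).fst (d n) = x n ∧ (τ n).D.L (d n) ≤ l' ∧ ‖d n‖ ≤ r + l' := by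
    filter_upwards [hx, hr, h1] with n h2 h3 h4
    obtain ⟨h5, h6⟩ := hd n h2
    refine ⟨h5, h6.le, ?_⟩
    have h7 := (τ n).norm_le_fst hl' h4 h6.le
    rw [h5] at h7
    simp only [NNReal.coe_one, mul_one] at h7
    linarith
  have hsnd : ∀ᶠ n in U, A.L ((τ n).snd (d n)) ≤ l' :=
    hd'.mono fun n h => ((τ n).isometry_snd.map_le _).trans h.2.1
  obtain ⟨a, ha⟩ := A.isLSeminorm.exists_tendsto U (M := r + l') hsnd
    (hd'.mono fun n h => (starAlgHom_norm_apply_le _ _).trans h.2.2)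
  refine ⟨a, ⟨r + l', d, ?_, ha⟩, A.isLSeminorm.le_of_tendsto hsnd ha⟩
  filter_upwards [hd'] with n h
  refine ⟨LipBounded.of_isSelfAdjoint (τ n).D.isLSeminorm (h.2.1.trans ?_) ?_, h.1⟩
  · exact_mod_cast le_add_self
  · exact_mod_cast h.2.2

theorem exists_tunnelLim_of_lipBounded (hF : IsAdmissible F)
    (hF_fin : ∀ x y lx ly : ℝ≥0, F x y lx ly < ⊤)
    (hτ : Tendsto (fun n => (τ n).extent) U (𝓝 0)) {x : ∀ n, An n} {r : ℝ≥0}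
    (hx : ∀ᶠ n in U, LipBounded (An n).L r (x n)) : ∃ a : A, TunnelLim τ U x a := by
  have : ∀ n, ∃ y z : An n, LipBounded (An n).L r (x n) → (An n).L y ≤ r ∧ (An n).L z ≤ r ∧
      ‖y‖ ≤ r ∧ ‖z‖ ≤ r ∧ x n = y + Complex.I • z := by
    intro n
    by_cases h : LipBounded (An n).L r (x n)
    · obtain ⟨y, z, h'⟩ := h
      exact ⟨y, z, fun _ => h'⟩
    · exact ⟨0, 0, fun h' => absurd h' h⟩
  choose y z hyz using this
  have hr : r < r + 1 := lt_add_one r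
  obtain ⟨a, ha, -⟩ := exists_tunnelLim_of_le (x := y) hτ hr
    (hx.mono fun n h => (hyz n h).1) (hx.mono fun n h => (hyz n h).2.2.1)
  obtain ⟨b, hb, -⟩ := exists_tunnelLim_of_le (x := z) hτ hr
    (hx.mono fun n h => (hyz n h).2.1) (hx.mono fun n h => (hyz n h).2.2.2.1)
  obtain ⟨s, d, hd, hd'⟩ := ha.add (hb.smul hF hF_fin Complex.I)
  refine ⟨_, s, d, ?_, hd'⟩
  filter_upwards [hd, hx] with n h1 h2
  exact ⟨h1.1, h1.2.trans (hyz n h2).2.2.2.2.symm⟩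

/-- Uniqueness of limits removes the slack: the same a is obtained for every bound larger than l. -/
theorem TunnelLim.seminorm_le (hF : IsAdmissible F)
    (hF_fin : ∀ x y lx ly : ℝ≥0, F x y lx ly < ⊤)
    (hτ : Tendsto (fun n => (τ n).extent) U (𝓝 0)) {x : ∀ n, An n} {a : A}
    (hx : TunnelLim τ U x a) {l : ℝ≥0} (hl : ∀ᶠ n in U, (An n).L (x n) ≤ l) : A.L a ≤ l := by
  refine ENNReal.le_of_forall_pos_le_add fun ε hε _ => ?_
  have hr : ∀ᶠ n in U, ‖x n‖ ≤ (‖a‖₊ + 1 : ℝ≥0) :=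
    ((hx.tendsto_norm hF hF_fin hτ).eventually (gt_mem_nhds (lt_add_one _))).mono
      fun n h => by push_cast; exact h.le
  obtain ⟨b, hb, hb'⟩ := exists_tunnelLim_of_le hτ (lt_add_of_pos_right l hε) hl hr
  rw [hx.unique hF hF_fin hτ hb]
  exact_mod_cast hb'

/-- Lift a itself to every tunnel algebra and project the lifts to the other end. -/
theorem exists_tunnelLim_eq (hτ : Tendsto (fun n => (τ n).extent) U (𝓝 0)) {a : A} {l : ℝ≥0}
    (ha : A.L a < l) : ∃ x : ∀ n, An n, (∀ n, (An n).L (x n) ≤ l) ∧ TunnelLim τ U x a := by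
  have hlift : ∀ n, ∃ d : (τ n).D, (τ n).snd d = a ∧ (τ n).D.L d < l := fun n =>
    (τ n).isometry_snd.exists_lift ha
  choose d hd hdl using hlift
  have hl : 0 < l := ENNReal.coe_pos.1 ((zero_le).trans_lt ha)
  have h1 : ∀ᶠ n in U, (τ n).extent < ((1 : ℝ≥0) : ℝ≥0∞) :=
    hτ.eventually (gt_mem_nhds (by simp))
  refine ⟨fun n => (τ n).fst (d n), fun n => ((τ n).isometry_fst.map_le _).trans (hdl n).le,
    ‖a‖₊ + l, d, ?_, by simp [hd]⟩
  filter_upwards [h1] with n h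
  refine ⟨LipBounded.of_isSelfAdjoint (τ n).D.isLSeminorm ((hdl n).le.trans ?_) ?_, rfl⟩
  · exact_mod_cast le_add_self
  · have := (τ n).norm_le_snd hl h (hdl n).le
    rw [hd n] at this
    push_cast
    simpa using this

/-- The radius of A passes through the tunnel: a lift of seminorm below 2 is within 2C of a scalar
once projected to A, and an extent below 1 adds at most 2. -/
theorem exists_uniform_radius (hτ : Tendsto (fun n => (τ n).extent) U (𝓝 0)) :
    ∃ C : ℝ≥0, ∀ᶠ n in U, ∀ x : An n, (An n).L x ≤ 1 →
      ∃ t : ℝ, ‖x - (t : ℂ) • (1 : An n)‖ ≤ C := by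
  obtain ⟨C, hC⟩ := A.isLSeminorm.exists_radius
  have h1 : ∀ᶠ n in U, (τ n).extent < ((1 : ℝ≥0) : ℝ≥0∞) :=
    hτ.eventually (gt_mem_nhds (by simp))
  refine ⟨2 * C + 2, h1.mono fun n hn x hx => ?_⟩
  obtain ⟨d, hd, hdl⟩ := (τ n).isometry_fst.exists_lift
    (hx.trans_lt (show (1 : ℝ≥0∞) < ((2 : ℝ≥0) : ℝ≥0∞) by norm_cast))
  obtain ⟨t, ht⟩ := hC ((τ n).snd d) 2 (by norm_num)
    (((τ n).isometry_snd.map_le d).trans hdl.le)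
  refine ⟨t, ?_⟩
  have h2 := (τ n).norm_le_snd (by norm_num) hn
    (((τ n).D.isLSeminorm.map_sub_real_smul_one_le d t).trans hdl.le)
  have h3 := starAlgHom_norm_apply_le (τ n).fst (d - (t : ℂ) • 1)
  rw [map_sub, map_smul, map_one, hd] at h3
  rw [map_sub, map_smul, map_one] at h2
  push_cast at ht h2 ⊢
  linarith

end TunnelLimit

/-! ### Limits of operators -/

section LimitOperator

variable {F : ℝ≥0∞ → ℝ≥0∞ → ℝ≥0∞ → ℝ≥0∞ → ℝ≥0∞} {An : ℕ → QQCMS.{u} F} {A : QQCMS.{u} F}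

/-- The elements that are limits of sequences through the tunnels `τ n`. -/
def tunnelLimSubmodule (hF : IsAdmissible F) (hF_fin : ∀ x y lx ly : ℝ≥0, F x y lx ly < ⊤)
    (τ : ∀ n, Tunnel (An n) A) (U : Ultrafilter ℕ) : Submodule ℂ A where
  carrier := {a | ∃ x, TunnelLim τ U x a}
  add_mem' := fun ⟨_, hx⟩ ⟨_, hy⟩ => ⟨_, hx.add hy⟩
  zero_mem' := ⟨_, by simpa using TunnelLim.smul_one (τ := τ) (U := U) 0⟩
  smul_mem' := fun c _ ⟨_, hx⟩ => ⟨_, hx.smul hF hF_fin c⟩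

variable {τ : ∀ n, Tunnel (An n) A} {U : Ultrafilter ℕ}

theorem exists_tunnelLim_of_lt_top (hτ : Tendsto (fun n => (τ n).extent) U (𝓝 0)) {a : A}
    (ha : A.L a < ⊤) : ∃ x : ∀ n, An n, TunnelLim τ U x a := by
  obtain ⟨l, hl, -⟩ := ENNReal.lt_iff_exists_nnreal_btwn.1 ha
  obtain ⟨x, -, hx⟩ := exists_tunnelLim_eq hτ hl
  exact ⟨x, hx⟩

theorem dense_submodule_of_forall_lt_top {B : QQCMS.{u} F} {S : Submodule ℂ B}
    (hS : ∀ a : B, B.L a < ⊤ → a ∈ S) : Dense (S : Set B) := by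
  have hsa : ∀ a : B, IsSelfAdjoint a → a ∈ S.topologicalClosure := fun a ha =>
    closure_mono (fun b hb => hS b hb) (B.isLSeminorm.dense a ha)
  intro a
  change a ∈ S.topologicalClosure
  rw [← realPart_add_I_smul_imaginaryPart a]
  exact add_mem (hsa _ (realPart a).2) (S.topologicalClosure.smul_mem _ (hsa _ (imaginaryPart a).2))

theorem dense_tunnelLimSubmodule (hF : IsAdmissible F)
    (hF_fin : ∀ x y lx ly : ℝ≥0, F x y lx ly < ⊤)
    (hτ : Tendsto (fun n => (τ n).extent) U (𝓝 0)) :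
    Dense (tunnelLimSubmodule hF hF_fin τ U : Set A) :=
  dense_submodule_of_forall_lt_top fun _ ha => exists_tunnelLim_of_lt_top hτ ha

theorem LipBounded.apply {B : QQCMS.{u} F} {β : B →L[ℂ] B} {c r : ℝ≥0} (hβ : ‖β‖ ≤ c)
    (hβL : ∀ a : B, B.L a < ⊤ → B.L (β a) ≤ c * B.L a) {z : B} (hz : LipBounded B.L r z) :
    LipBounded B.L (c * r) (β z) := by
  obtain ⟨x, y, h1, h2, h3, h4, rfl⟩ := hz
  have hL : ∀ a : B, B.L a ≤ r → B.L (β a) ≤ (c * r : ℝ≥0) := fun a ha => by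
    refine (hβL a (ha.trans_lt ENNReal.coe_lt_top)).trans ?_
    push_cast
    gcongr
  have hn : ∀ a : B, ‖a‖ ≤ r → ‖β a‖ ≤ (c * r : ℝ≥0) := fun a ha => by
    push_cast
    exact (β.le_opNorm a).trans (by gcongr)
  exact ⟨β x, β y, hL x h1, hL y h2, hn x h3, hn y h4, by simp⟩

/-- `γ` is the limit along `U` of the operators `β n`, seen through the tunnels `τ n`. -/
def IsLimitOperator (τ : ∀ n, Tunnel (An n) A) (U : Ultrafilter ℕ) (β : ∀ n, An n →L[ℂ] An n)
    (γ : A →L[ℂ] A) : Prop :=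
  ∀ (x : ∀ n, An n) (a : A), TunnelLim τ U x a → TunnelLim τ U (fun n => β n (x n)) (γ a)

/-- The operators keep sequences bounded, so image sequences have limits; passing the norm bounds to
the limit makes the induced map well defined and continuous on a dense subspace. -/
theorem exists_isLimitOperator (hF : IsAdmissible F)
    (hF_fin : ∀ x y lx ly : ℝ≥0, F x y lx ly < ⊤)
    (hτ : Tendsto (fun n => (τ n).extent) U (𝓝 0)) {β : ∀ n, An n →L[ℂ] An n}
    {c : ℕ → ℝ≥0} {c' : ℝ≥0} (hc : Tendsto c U (𝓝 c')) (hβ : ∀ n, ‖β n‖ ≤ c n)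
    (hβL : ∀ n (a : An n), (An n).L a < ⊤ → (An n).L (β n a) ≤ c n * (An n).L a) :
    ∃ γ : A →L[ℂ] A, ‖γ‖ ≤ c' ∧ IsLimitOperator τ U β γ := by
  have himage : ∀ (x : ∀ n, An n) (a : A), TunnelLim τ U x a →
      ∃ b : A, TunnelLim τ U (fun n => β n (x n)) b := by
    intro x a hx
    obtain ⟨r, hr⟩ := hx.exists_lipBounded
    have hc1 : ∀ᶠ n in U, c n < c' + 1 := hc.eventually (gt_mem_nhds (lt_add_one c'))
    refine exists_tunnelLim_of_lipBounded hF hF_fin hτ (r := (c' + 1) * r) ?_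
    filter_upwards [hr, hc1] with n h1 h2
    exact (h1.apply (hβ n) (hβL n)).mono (by gcongr)
  have hbound : ∀ (x : ∀ n, An n) (a b : A), TunnelLim τ U x a →
      TunnelLim τ U (fun n => β n (x n)) b → ‖b‖ ≤ c' * ‖a‖ := by
    intro x a b hx hb
    have h1 := hx.tendsto_norm hF hF_fin hτ
    have h2 := hb.tendsto_norm hF hF_fin hτ
    have h3 : Tendsto (fun n => (c n : ℝ) * ‖x n‖) U (𝓝 (c' * ‖a‖)) :=
      (((NNReal.continuous_coe.tendsto c').comp hc)).mul h1
    exact le_of_tendsto_of_tendsto' h2 h3 fun n =>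
      ((β n).le_opNorm _).trans (by gcongr; exact hβ n)
  -- Two representing sequences differ by one with limit 0, to which `hbound` applies.
  have huniq : ∀ (x y : ∀ n, An n) (a b b' : A), TunnelLim τ U x a → TunnelLim τ U y a →
      TunnelLim τ U (fun n => β n (x n)) b → TunnelLim τ U (fun n => β n (y n)) b' → b = b' := by
    intro x y a b b' hx hy hb hb'
    have h1 := hx.sub hF hF_fin hy
    have h2 := hb.sub hF hF_fin hb'
    have h3 := hbound _ _ (b - b') h1 (by simpa using h2)
    rw [sub_self, norm_zero, mul_zero] at h3
    exact sub_eq_zero.1 (norm_le_zero_iff.1 h3)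
  set S := tunnelLimSubmodule hF hF_fin τ U with hS
  have hex : ∀ a : S, ∃ x : ∀ n, An n, ∃ b : A, TunnelLim τ U x a ∧
      TunnelLim τ U (fun n => β n (x n)) b := by
    rintro ⟨a, x, hx⟩
    obtain ⟨b, hb⟩ := himage x a hx
    exact ⟨x, b, hx, hb⟩
  choose x f hx hf using hex
  let f' : S →ₗ[ℂ] A :=
    { toFun := f
      map_add' := fun a b => huniq _ _ _ _ _ (hx (a + b)) ((hx a).add (hx b)) (hf (a + b))
        (by simpa using (hf a).add (hf b))
      map_smul' := fun k a => huniq _ _ _ _ _ (hx (k • a)) ((hx a).smul hF hF_fin k)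
        (hf (k • a)) (by simpa using (hf a).smul hF hF_fin k) }
  have hdense : DenseRange S.subtype := by
    have := dense_tunnelLimSubmodule hF hF_fin hτ
    rw [DenseRange, Submodule.coe_subtype, Subtype.range_coe]
    exact this
  have hnorm : ∀ a : S, ‖f' a‖ ≤ c' * ‖S.subtype a‖ := fun a => hbound _ _ _ (hx a) (hf a)
  refine ⟨f'.extendOfNorm S.subtype, LinearMap.opNorm_extendOfNorm_le hdense c'.2 hnorm,
    fun y a hy => ?_⟩
  obtain ⟨b, hb⟩ := himage y a hy
  have h1 := f'.extendOfNorm_eq hdense ⟨c', hnorm⟩ ⟨a, y, hy⟩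
  have h2 : f'.extendOfNorm S.subtype a = b := h1.trans (huniq _ _ _ _ _ (hx _) hy (hf _) hb)
  rwa [h2]

end LimitOperator

/-! ### Positivity expressed by norms -/

section Positivity

variable {A : Type u} [CStarAlgebra A]

theorem norm_smul_one_sub_star_mul_self_le {b : A} {t : ℝ≥0} (h : ‖star b * b‖ ≤ t) :
    ‖((t : ℝ) : ℂ) • (1 : A) - star b * b‖ ≤ t := by
  let _ := CStarAlgebra.spectralOrder A
  have := CStarAlgebra.spectralOrderedRing A
  have h1 := (SpectrumRestricts.nnreal_iff_nnnorm (IsSelfAdjoint.star_mul_self b) h).1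
    (SpectrumRestricts.nnreal_of_nonneg (star_mul_self_nonneg b))
  rw [IsScalarTower.algebraMap_apply ℝ ℂ A, Algebra.algebraMap_eq_smul_one] at h1
  exact h1

/-- Norms are what survives in tunnel limits, so positivity has to be recovered from a norm
inequality. -/
theorem nonneg_of_norm_smul_one_sub_le [PartialOrder A] [StarOrderedRing A] {y : A}
    (hy : IsSelfAdjoint y) {t : ℝ≥0} (h : ‖y‖ ≤ t)
    (h' : ‖((t : ℝ) : ℂ) • (1 : A) - y‖ ≤ t) : 0 ≤ y := by
  rw [nonneg_iff_isSelfAdjoint_and_quasispectrumRestricts]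
  refine ⟨hy, (SpectrumRestricts.nnreal_iff_nnnorm hy h).2 ?_⟩
  rw [IsScalarTower.algebraMap_apply ℝ ℂ A, Algebra.algebraMap_eq_smul_one]
  exact h'

end Positivity

theorem ENNReal.le_mul_of_forall_gt {y c : ℝ≥0∞} {k : ℝ≥0} (hc : c ≠ ⊤)
    (h : ∀ l : ℝ≥0, c < l → y ≤ l * k) : y ≤ c * k := by
  lift c to ℝ≥0 using hc
  have h1 : Tendsto (fun l : ℝ≥0 => (l : ℝ≥0∞) * k) (𝓝[>] c) (𝓝 (c * k)) := by
    have : Continuous fun l : ℝ≥0 => (l : ℝ≥0∞) * k := by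
      simp_rw [← ENNReal.coe_mul]
      fun_prop
    exact (this.tendsto c).mono_left nhdsWithin_le_nhds
  refine ge_of_tendsto h1 ?_
  filter_upwards [self_mem_nhdsWithin] with l hl
  exact h l (ENNReal.coe_lt_coe.2 hl)

/-! ### Properties inherited by limit operators -/

namespace IsLimitOperator

variable {F : ℝ≥0∞ → ℝ≥0∞ → ℝ≥0∞ → ℝ≥0∞ → ℝ≥0∞} {An : ℕ → QQCMS.{u} F} {A : QQCMS.{u} F}
  {τ : ∀ n, Tunnel (An n) A} {U : Ultrafilter ℕ} {β β' : ∀ n, An n →L[ℂ] An n}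
  {γ γ' : A →L[ℂ] A}

theorem one : IsLimitOperator τ U (fun _ => 1) 1 := fun _ _ hx => hx

theorem mul (hβ : IsLimitOperator τ U β γ) (hβ' : IsLimitOperator τ U β' γ') :
    IsLimitOperator τ U (fun n => β n * β' n) (γ * γ') := fun x a hx => hβ _ _ (hβ' x a hx)

theorem tendsto_enorm_sub (hF : IsAdmissible F) (hF_fin : ∀ x y lx ly : ℝ≥0, F x y lx ly < ⊤)
    (hτ : Tendsto (fun n => (τ n).extent) U (𝓝 0)) (hβ : IsLimitOperator τ U β γ)
    (hβ' : IsLimitOperator τ U β' γ') {x : ∀ n, An n} {a : A} (hx : TunnelLim τ U x a) :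
    Tendsto (fun n => ‖β n (x n) - β' n (x n)‖ₑ) U (𝓝 ‖γ a - γ' a‖ₑ) := by
  have h := ((hβ x a hx).sub hF hF_fin (hβ' x a hx)).tendsto_norm hF hF_fin hτ
  simpa [ofReal_norm] using ENNReal.tendsto_ofReal h

theorem map_one_eq (hF : IsAdmissible F) (hF_fin : ∀ x y lx ly : ℝ≥0, F x y lx ly < ⊤)
    (hτ : Tendsto (fun n => (τ n).extent) U (𝓝 0)) (hβ : IsLimitOperator τ U β γ)
    (h1 : ∀ n, β n 1 = 1) : γ 1 = 1 := by
  have h := hβ _ _ TunnelLim.one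
  simp only [h1] at h
  exact h.unique hF hF_fin hτ TunnelLim.one

theorem enorm_sub_le (hF : IsAdmissible F) (hF_fin : ∀ x y lx ly : ℝ≥0, F x y lx ly < ⊤)
    (hτ : Tendsto (fun n => (τ n).extent) U (𝓝 0)) (hβ : IsLimitOperator τ U β γ)
    (hβ' : IsLimitOperator τ U β' γ') {k : ℕ → ℝ≥0} {k' : ℝ≥0} (hk : Tendsto k U (𝓝 k'))
    (h : ∀ n (a : An n), (An n).L a < ⊤ → ‖β n a - β' n a‖ₑ ≤ k n * (An n).L a) {a : A}
    (ha : A.L a < ⊤) : ‖γ a - γ' a‖ₑ ≤ A.L a * k' := by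
  refine ENNReal.le_mul_of_forall_gt ha.ne fun l hl => ?_
  obtain ⟨x, hxl, hx⟩ := exists_tunnelLim_eq hτ hl
  have h1 : Tendsto (fun n => ((l * k n : ℝ≥0) : ℝ≥0∞)) U (𝓝 ((l * k' : ℝ≥0) : ℝ≥0∞)) :=
    ENNReal.tendsto_coe.2 (hk.const_mul l)
  have h2 := le_of_tendsto_of_tendsto' (hβ.tendsto_enorm_sub hF hF_fin hτ hβ' hx) h1 fun n => by
    refine (h n (x n) ((hxl n).trans_lt ENNReal.coe_lt_top)).trans ?_
    push_cast
    rw [mul_comm]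
    gcongr
    exact hxl n
  simpa using h2

/-- This turns approximate identities between operators into exact ones: an error vanishing relative
to the seminorm is invisible on the domain, which spans a dense subspace. -/
theorem eq_of_tendsto (hF : IsAdmissible F) (hF_fin : ∀ x y lx ly : ℝ≥0, F x y lx ly < ⊤)
    (hτ : Tendsto (fun n => (τ n).extent) U (𝓝 0)) (hβ : IsLimitOperator τ U β γ)
    (hβ' : IsLimitOperator τ U β' γ') {k : ℕ → ℝ≥0} (hk : Tendsto k U (𝓝 0))
    (h : ∀ n (a : An n), (An n).L a < ⊤ → ‖β n a - β' n a‖ₑ ≤ k n * (An n).L a) : γ = γ' := by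
  have hd : Dense
      ((LinearMap.eqLocus (γ : A →ₗ[ℂ] A) (γ' : A →ₗ[ℂ] A) : Submodule ℂ A) : Set A) := by
    refine dense_submodule_of_forall_lt_top fun a ha => ?_
    have h1 := hβ.enorm_sub_le hF hF_fin hτ hβ' hk h ha
    simp only [ENNReal.coe_zero, mul_zero, nonpos_iff_eq_zero, enorm_eq_zero] at h1
    exact sub_eq_zero.1 h1
  exact ContinuousLinearMap.coeFn_injective
    (Continuous.ext_on hd γ.continuous γ'.continuous fun a ha => ha)

theorem seminorm_le (hF : IsAdmissible F) (hF_fin : ∀ x y lx ly : ℝ≥0, F x y lx ly < ⊤)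
    (hτ : Tendsto (fun n => (τ n).extent) U (𝓝 0)) (hβ : IsLimitOperator τ U β γ)
    {c : ℕ → ℝ≥0} {c' : ℝ≥0} (hc : Tendsto c U (𝓝 c'))
    (h : ∀ n (a : An n), (An n).L a < ⊤ → (An n).L (β n a) ≤ c n * (An n).L a) {a : A}
    (ha : A.L a < ⊤) : A.L (γ a) ≤ c' * A.L a := by
  rw [mul_comm]
  refine ENNReal.le_mul_of_forall_gt ha.ne fun l hl => ?_
  rw [mul_comm]
  refine ENNReal.le_mul_of_forall_gt ENNReal.coe_ne_top fun q hq => ?_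
  obtain ⟨x, hxl, hx⟩ := exists_tunnelLim_eq hτ hl
  rw [← ENNReal.coe_mul]
  refine (hβ x a hx).seminorm_le hF hF_fin hτ ?_
  filter_upwards [hc.eventually (gt_mem_nhds (ENNReal.coe_lt_coe.1 hq))] with n hn
  refine (h n (x n) ((hxl n).trans_lt ENNReal.coe_lt_top)).trans ?_
  push_cast
  gcongr
  exact hxl n

theorem mkDist_le_limsup (hF : IsAdmissible F) (hF_fin : ∀ x y lx ly : ℝ≥0, F x y lx ly < ⊤)
    (hτ : Tendsto (fun n => (τ n).extent) U (𝓝 0)) (hU : (U : Filter ℕ) ≤ atTop)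
    (hβ : IsLimitOperator τ U β γ) (hβ' : IsLimitOperator τ U β' γ') :
    mkDist γ γ' ≤ limsup (fun n => mkDist (β n) (β' n)) atTop := by
  refine iSup₂_le fun a ha => ?_
  -- Lifting requires a strict seminorm bound, so a is first shrunk by t < 1.
  have h1 : Tendsto (fun t : ℝ => ‖(t : ℂ) • (γ a - γ' a)‖ₑ) (𝓝[<] 1) (𝓝 ‖γ a - γ' a‖ₑ) := by
    have : Continuous fun t : ℝ => ‖(t : ℂ) • (γ a - γ' a)‖ₑ := by fun_prop
    simpa using (this.tendsto 1).mono_left nhdsWithin_le_nhds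
  refine le_of_tendsto h1 ?_
  filter_upwards [Ioo_mem_nhdsLT zero_lt_one] with t ht
  have hta : A.L ((t : ℂ) • a) < ((1 : ℝ≥0) : ℝ≥0∞) := by
    refine (A.isLSeminorm.map_real_smul_le t a).trans_lt ?_
    calc ‖t‖ₑ * A.L a ≤ ‖t‖ₑ * 1 := by gcongr
      _ < ((1 : ℝ≥0) : ℝ≥0∞) := by
        rw [mul_one, Real.enorm_of_nonneg ht.1.le, ENNReal.coe_one, ENNReal.ofReal_lt_one]
        exact ht.2
  obtain ⟨x, hxl, hx⟩ := exists_tunnelLim_eq hτ hta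
  have h2 := hβ.tendsto_enorm_sub hF hF_fin hτ hβ' hx
  rw [map_smul, map_smul, ← smul_sub] at h2
  refine le_of_forall_gt fun w hw => ?_
  obtain ⟨w', hw', hw''⟩ := exists_between hw
  refine lt_of_le_of_lt (le_of_tendsto h2 ?_) hw''
  filter_upwards [hU (eventually_lt_of_limsup_lt hw')] with n hn
  exact (le_iSup₂ (f := fun (a : An n) (_ : (An n).L a ≤ 1) => ‖β n a - β' n a‖ₑ) (x n)
    (by simpa using hxl n)).trans (le_of_lt hn)

/-- Elements nearly attaining the distances may be unbounded in norm. Unital maps do not see the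
subtraction of a scalar in their difference, so the uniform radius bounds these elements and gives
them a limit. -/
theorem liminf_le_mkDist (hF : IsAdmissible F) (hF_fin : ∀ x y lx ly : ℝ≥0, F x y lx ly < ⊤)
    (hτ : Tendsto (fun n => (τ n).extent) U (𝓝 0)) (hU : (U : Filter ℕ) ≤ atTop)
    (hβ : IsLimitOperator τ U β γ) (hβ' : IsLimitOperator τ U β' γ') (h1 : ∀ n, β n 1 = 1)
    (h1' : ∀ n, β' n 1 = 1) :
    liminf (fun n => mkDist (β n) (β' n)) atTop ≤ mkDist γ γ' := by
  refine le_of_forall_lt_imp_le_of_dense fun v hv => ?_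
  obtain ⟨C, hC⟩ := exists_uniform_radius hτ
  have hex : ∀ᶠ n in U, ∃ x : An n, (An n).L x ≤ 1 ∧ ‖x‖ ≤ C ∧ v < ‖β n x - β' n x‖ₑ := by
    filter_upwards [hU (eventually_lt_of_lt_liminf hv), hC] with n hn hCn
    change v < mkDist (β n) (β' n) at hn
    rw [mkDist, lt_iSup_iff] at hn
    obtain ⟨x, hn⟩ := hn
    rw [lt_iSup_iff] at hn
    obtain ⟨hx, hn⟩ := hn
    obtain ⟨t, ht⟩ := hCn x hx
    refine ⟨x - (t : ℂ) • 1, ((An n).isLSeminorm.map_sub_real_smul_one_le x t).trans hx, ht, ?_⟩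
    simpa only [map_sub, map_smul, h1, h1', sub_sub_sub_cancel_right] using hn
  have hex' : ∀ n, ∃ x : An n, (∃ x : An n, (An n).L x ≤ 1 ∧ ‖x‖ ≤ C ∧ v < ‖β n x - β' n x‖ₑ) →
      (An n).L x ≤ 1 ∧ ‖x‖ ≤ C ∧ v < ‖β n x - β' n x‖ₑ := by
    intro n
    by_cases h : ∃ x : An n, (An n).L x ≤ 1 ∧ ‖x‖ ≤ C ∧ v < ‖β n x - β' n x‖ₑ
    · obtain ⟨x, hx⟩ := h
      exact ⟨x, fun _ => hx⟩
    · exact ⟨0, fun h' => absurd h' h⟩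
  choose x hx using hex'
  have hx' := hex.mono fun n h => hx n h
  have hx1 : ∀ᶠ n in U, (An n).L (x n) ≤ ((1 : ℝ≥0) : ℝ≥0∞) := hx'.mono fun n h => by
    simpa using h.1
  obtain ⟨a, ha, -⟩ := exists_tunnelLim_of_le hτ (lt_add_one (1 : ℝ≥0)) hx1
    (hx'.mono fun n h => h.2.1)
  have ha1 := ha.seminorm_le hF hF_fin hτ hx1
  refine (ge_of_tendsto (hβ.tendsto_enorm_sub hF hF_fin hτ hβ' ha)
    (hx'.mono fun n h => h.2.2.le)).trans ?_
  exact le_iSup₂ (f := fun (a : A) (_ : A.L a ≤ 1) => ‖γ a - γ' a‖ₑ) a (by simpa using ha1)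

theorem isPositiveMap (hF : IsAdmissible F) (hF_fin : ∀ x y lx ly : ℝ≥0, F x y lx ly < ⊤)
    (hτ : Tendsto (fun n => (τ n).extent) U (𝓝 0)) (hβ : IsLimitOperator τ U β γ)
    (hpos : ∀ n, IsPositiveMap (β n)) : IsPositiveMap γ := by
  let _ := CStarAlgebra.spectralOrder A
  have := CStarAlgebra.spectralOrderedRing A
  intro a
  rw [← CStarAlgebra.nonneg_iff_eq_star_mul_self]
  have hcont : Continuous fun a : A => γ (star a * a) := by fun_prop
  have hclosed : IsClosed {a : A | 0 ≤ γ (star a * a)} :=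
    (CStarAlgebra.isClosed_nonneg (A := A)).preimage hcont
  refine (dense_tunnelLimSubmodule hF hF_fin hτ).induction (P := fun a => 0 ≤ γ (star a * a))
    ?_ hclosed a
  rintro a ⟨x, hx⟩
  have hlim := hβ _ _ (hx.star.mul hF hF_fin hx)
  have hsq : ∀ n, ∃ b, β n (star (x n) * x n) = star b * b := fun n => hpos n (x n)
  choose b hb using hsq
  have hsa : IsSelfAdjoint (γ (star a * a)) := by
    refine TunnelLim.unique hF hF_fin hτ ?_ hlim
    simpa [hb] using hlim.star
  have ht : ∀ᶠ n in U, ‖β n (star (x n) * x n)‖ ≤ (‖γ (star a * a)‖₊ + 1 : ℝ≥0) :=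
    ((hlim.tendsto_norm hF hF_fin hτ).eventually (gt_mem_nhds (lt_add_one _))).mono
      fun n h => by push_cast; exact h.le
  refine nonneg_of_norm_smul_one_sub_le hsa (t := ‖γ (star a * a)‖₊ + 1) (by simp) ?_
  -- The inequality ‖t1 - y‖ ≤ t holds for the positive images in `An n` and passes to the limit.
  refine le_of_tendsto (((TunnelLim.smul_one _).sub hF hF_fin hlim).tendsto_norm hF hF_fin hτ) ?_
  filter_upwards [ht] with n hn
  rw [hb n] at hn ⊢
  exact norm_smul_one_sub_star_mul_self_le hn

theorem map_mul_eq (hF : IsAdmissible F) (hF_fin : ∀ x y lx ly : ℝ≥0, F x y lx ly < ⊤)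
    (hτ : Tendsto (fun n => (τ n).extent) U (𝓝 0)) (hβ : IsLimitOperator τ U β γ)
    (h : ∀ n (a b : An n), β n (a * b) = β n a * β n b) (a b : A) : γ (a * b) = γ a * γ b := by
  have hd : DenseRange (Subtype.val : tunnelLimSubmodule hF hF_fin τ U → A) :=
    (dense_tunnelLimSubmodule hF hF_fin hτ).denseRange_val
  refine isClosed_property2 hd (p := fun a b => γ (a * b) = γ a * γ b)
    (isClosed_eq (by fun_prop) (by fun_prop)) ?_ a b
  rintro ⟨a, x, hx⟩ ⟨b, y, hy⟩
  have h1 := hβ _ _ (hx.mul hF hF_fin hy)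
  simp only [h] at h1
  exact h1.unique hF hF_fin hτ ((hβ _ _ hx).mul hF hF_fin (hβ _ _ hy))

theorem map_star_eq (hF : IsAdmissible F) (hF_fin : ∀ x y lx ly : ℝ≥0, F x y lx ly < ⊤)
    (hτ : Tendsto (fun n => (τ n).extent) U (𝓝 0)) (hβ : IsLimitOperator τ U β γ)
    (h : ∀ n (a : An n), β n (star a) = star (β n a)) (a : A) : γ (star a) = star (γ a) := by
  refine (dense_tunnelLimSubmodule hF hF_fin hτ).induction
    (P := fun a => γ (star a) = star (γ a)) ?_ (isClosed_eq (by fun_prop) (by fun_prop)) a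
  rintro a ⟨x, hx⟩
  have h1 := hβ _ _ hx.star
  simp only [h] at h1
  exact h1.unique hF hF_fin hτ (hβ _ _ hx).star

end IsLimitOperator

/-! ### Choice of tunnels and strong continuity -/

section Action

variable {F : ℝ≥0∞ → ℝ≥0∞ → ℝ≥0∞ → ℝ≥0∞ → ℝ≥0∞}

theorem exists_tunnel_extent_le {T : ∀ A B : QQCMS.{u} F, Tunnel A B → Prop} {A B : QQCMS.{u} F}
    (h : ∃ τ : Tunnel A B, T A B τ) {δ : ℝ≥0∞} (hδ : δ ≠ 0) :
    ∃ τ : Tunnel A B, T A B τ ∧ τ.extent ≤ propinquity T A B + δ := by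
  rcases eq_or_ne (propinquity T A B) ⊤ with htop | htop
  · obtain ⟨τ, hτ⟩ := h
    exact ⟨τ, hτ, by simp [htop]⟩
  · have h1 := ENNReal.lt_add_right htop hδ
    conv_lhs at h1 => rw [propinquity]
    simp only [iInf_lt_iff] at h1
    obtain ⟨τ, hτ, h2⟩ := h1
    exact ⟨τ, hτ, h2.le⟩

theorem exists_tunnels_tendsto {C : QQCMS.{u} F → Prop}
    {T : ∀ A B : QQCMS.{u} F, Tunnel A B → Prop} (hCT : IsAppropriate C T) {An : ℕ → QQCMS.{u} F}
    (hAn : ∀ n, C (An n)) {A : QQCMS.{u} F} (hA : C A)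
    (hlim : Tendsto (fun n => propinquity T (An n) A) atTop (𝓝 0)) :
    ∃ τ : ∀ n, Tunnel (An n) A, Tendsto (fun n => (τ n).extent) atTop (𝓝 0) := by
  -- The slack is 1/n, equal to ∞ at n = 0, hence never zero.
  have hex := fun n : ℕ => exists_tunnel_extent_le (hCT.exists_tunnel (An n) A (hAn n) hA)
    (ENNReal.inv_ne_zero.2 (ENNReal.natCast_ne_top n))
  choose τ _ hτ using hex
  have h0 : Tendsto (fun n : ℕ => propinquity T (An n) A + (n : ℝ≥0∞)⁻¹) atTop (𝓝 0) := by
    simpa using hlim.add ENNReal.tendsto_inv_nat_nhds_zero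
  exact ⟨τ, tendsto_of_tendsto_of_tendsto_of_le_of_le tendsto_const_nhds h0
    (fun _ => zero_le) hτ⟩

/-- Strong continuity follows from continuity on the domain of the seminorm. -/
theorem continuous_apply_of_enorm_sub_le {G : Type v} [MetricSpace G] {A : QQCMS.{u} F}
    {α : G → A →L[ℂ] A} {M : ℝ≥0} (hM : ∀ g, ‖α g‖ ≤ M) {K : ℝ≥0 → ℝ≥0} (hK : Continuous K)
    (hK0 : K 0 = 0)
    (h : ∀ (g h : G) (a : A), A.L a < ⊤ → ‖α g a - α h a‖ₑ ≤ A.L a * K (nndist g h)) (a : A) :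
    Continuous fun g => α g a := by
  let V : Submodule ℂ A :=
    { carrier := {a | Continuous fun g => α g a}
      add_mem' := fun {a b} ha hb => by
        simp only [Set.mem_ofPred_eq, map_add] at *
        exact ha.add hb
      zero_mem' := by simp [continuous_const]
      smul_mem' := fun c a ha => by
        simp only [Set.mem_ofPred_eq, map_smul] at *
        exact ha.const_smul c }
  have hV : Dense (V : Set A) := by
    refine dense_submodule_of_forall_lt_top fun a ha => continuous_iff_continuousAt.2 fun g => ?_
    rw [ContinuousAt, tendsto_iff_edist_tendsto_0]
    have h1 : Tendsto (fun g' => A.L a * K (nndist g' g)) (𝓝 g) (𝓝 0) := by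
      have h2 : Tendsto (fun g' => K (nndist g' g)) (𝓝 g) (𝓝 0) := by
        have : Continuous fun g' => K (nndist g' g) := by fun_prop
        simpa [hK0] using this.tendsto g
      have h3 := ENNReal.Tendsto.const_mul (a := A.L a) (ENNReal.tendsto_coe.2 h2) (.inr ha.ne)
      simpa using h3
    refine tendsto_of_tendsto_of_tendsto_of_le_of_le tendsto_const_nhds h1 (fun _ => zero_le)
      fun g' => ?_
    rw [edist_eq_enorm_sub]
    exact h g' g a ha
  refine continuous_of_uniform_approx_of_continuous fun u hu => ?_
  obtain ⟨ε, hε, hεu⟩ := Metric.mem_uniformity_dist.1 hu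
  -- Orbit maps of elements close to a are uniformly close to that of a; M + 1 avoids dividing by
  -- zero.
  have hδ : 0 < ε / (M + 1) := by positivity
  obtain ⟨b, hb, hab⟩ := Metric.dense_iff.1 hV a _ hδ
  refine ⟨fun g => α g b, hab, fun g => hεu ?_⟩
  rw [dist_eq_norm, ← map_sub]
  rw [Metric.mem_ball, dist_comm, dist_eq_norm] at hb
  calc ‖α g (a - b)‖ ≤ M * ‖a - b‖ := (α g).le_of_opNorm_le (hM g) _
    _ ≤ (M + 1) * ‖a - b‖ := by gcongr; linarith
    _ < (M + 1) * (ε / (M + 1)) := by gcongr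
    _ = ε := by field_simp

theorem tendsto_nndist_of_le {δ : ℕ → ℝ} (hδ : Tendsto δ atTop (𝓝 0)) {X : ℕ → Type*}
    [∀ n, MetricSpace (X n)] {x y : ∀ n, X n} (h : ∀ n, dist (x n) (y n) ≤ δ n) :
    Tendsto (fun n => nndist (x n) (y n)) atTop (𝓝 0) := by
  rw [← NNReal.tendsto_coe]
  exact squeeze_zero (fun _ => dist_nonneg) h hδ

end Action

/-! ### The limit action -/

theorem mainTheorem2
    {F : ℝ≥0∞ → ℝ≥0∞ → ℝ≥0∞ → ℝ≥0∞ → ℝ≥0∞} (hF : IsAdmissible F)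
    (hF_fin : ∀ x y lx ly : ℝ≥0, F x y lx ly < ⊤)
    -- the monoids and the near isometric isomorphisms
    {G : Type v} [Monoid G] [MetricSpace G] [CompactSpace G] [ContinuousMul G]
    {Gn : ℕ → Type w} [∀ n, Monoid (Gn n)] [∀ n, MetricSpace (Gn n)]
    [∀ n, CompactSpace (Gn n)] [∀ n, ContinuousMul (Gn n)]
    (ε : ℕ → ℝ) (hε_pos : ∀ n, 0 < ε n) (hε : Tendsto ε atTop (𝓝 0))
    (ς : ∀ n, Gn n → G) (κ : ∀ n, G → Gn n) (hςκ : ∀ n, IsNearIso (ε n) (ς n) (κ n))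
    -- the bounds
    (D : G → ℝ≥0) (hD : Continuous D)
    (K : ℝ≥0 → ℝ≥0) (hK : Continuous K) (hK0 : K 0 = 0)
    -- the quantum metric spaces
    (C : QQCMS.{u} F → Prop) (T : ∀ A B : QQCMS.{u} F, Tunnel A B → Prop)
    (hCT : IsAppropriate C T)
    (An : ℕ → QQCMS.{u} F) (hAn : ∀ n, C (An n))
    (A : QQCMS.{u} F) (hA : C A)
    (hlim : Tendsto (fun n => propinquity T (An n) A) atTop (𝓝 0))
    -- the actions
    (αn : ∀ n, Gn n →* (An n →L[ℂ] An n))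
    (hαn_lip : ∀ n g, IsLipschitzLinear (αn n g))
    (hαn_norm : ∀ n g, ‖αn n g‖ ≤ D (ς n g))
    (hαn_L : ∀ n g (a : An n), (An n).L a < ⊤ →
      (An n).L (αn n g a) ≤ D (ς n g) * (An n).L a)
    (hαn_K : ∀ n (g g' : Gn n) (a : An n), (An n).L a < ⊤ →
      ‖αn n g a - αn n g' a‖ₑ ≤ K (nndist g g') * (An n).L a) :
    ∃ α : G →* (A →L[ℂ] A),
      (∀ a : A, Continuous fun g => α g a) ∧
      (∀ g, IsLipschitzLinear (α g)) ∧
      (∀ g, ‖α g‖ ≤ D g) ∧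
      (∀ g (a : A), A.L a < ⊤ → A.L (α g a) ≤ D g * A.L a) ∧
      (∀ g h : G,
        liminf (fun n => mkDist (αn n (κ n g)) (αn n (κ n h))) atTop ≤ mkDist (α g) (α h) ∧
        mkDist (α g) (α h) ≤ limsup (fun n => mkDist (αn n (κ n g)) (αn n (κ n h))) atTop) ∧
      (∀ (g h : G) (a : A), A.L a < ⊤ → ‖α g a - α h a‖ₑ ≤ A.L a * K (nndist g h)) ∧
      ((∀ n g, IsPositiveMap (αn n g)) → ∀ g, IsPositiveMap (α g)) ∧
      ((∀ n g, IsLipschitzMorphism (αn n g)) → ∀ g, IsLipschitzMorphism (α g)) := by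
  obtain ⟨τ, hτ'⟩ := exists_tunnels_tendsto hCT hAn hA hlim
  let U : Ultrafilter ℕ := hyperfilter ℕ
  have hU : (U : Filter ℕ) ≤ atTop := Nat.hyperfilter_le_atTop
  have hτ : Tendsto (fun n => (τ n).extent) U (𝓝 0) := hτ'.mono_left hU
  -- The bounds are evaluated at ς_n(κ_n(g)), which is within ε_n of g.
  have hDlim : ∀ g, Tendsto (fun n => D (ς n (κ n g))) U (𝓝 (D g)) := fun g => by
    have h1 : Tendsto (fun n => ς n (κ n g)) atTop (𝓝 g) :=
      tendsto_iff_dist_tendsto_zero.2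
        (squeeze_zero (fun _ => dist_nonneg) (fun n => (hςκ n).2.left_inv g) hε)
    exact ((hD.tendsto g).comp h1).mono_left hU
  have hKlim : ∀ (x y : ∀ n, Gn n) (δ : ℝ≥0), Tendsto (fun n => nndist (x n) (y n)) atTop (𝓝 δ) →
      Tendsto (fun n => K (nndist (x n) (y n))) U (𝓝 (K δ)) := fun x y δ h =>
    ((hK.tendsto δ).comp h).mono_left hU
  have hKlim0 : ∀ x y : ∀ n, Gn n, (∀ n, dist (x n) (y n) ≤ ε n) →
      Tendsto (fun n => K (nndist (x n) (y n))) U (𝓝 0) := fun x y h =>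
    hK0 ▸ hKlim x y 0 (tendsto_nndist_of_le hε h)
  have hop := fun g : G => exists_isLimitOperator hF hF_fin hτ (β := fun n => αn n (κ n g))
    (hDlim g) (fun n => hαn_norm n (κ n g)) (fun n => hαn_L n (κ n g))
  choose γ hγn hγ using hop
  have hγL : ∀ g (a : A), A.L a < ⊤ → A.L (γ g a) ≤ D g * A.L a := fun g a ha =>
    (hγ g).seminorm_le hF hF_fin hτ (hDlim g) (fun n => hαn_L n (κ n g)) ha
  have hγK : ∀ (g h : G) (a : A), A.L a < ⊤ → ‖γ g a - γ h a‖ₑ ≤ A.L a * K (nndist g h) := by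
    intro g h a ha
    refine (hγ g).enorm_sub_le hF hF_fin hτ (hγ h) (hKlim _ _ _ ?_)
      (fun n => hαn_K n (κ n g) (κ n h)) ha
    rw [← NNReal.tendsto_coe]
    refine tendsto_iff_dist_tendsto_zero.2 (squeeze_zero (fun _ => dist_nonneg) (fun n => ?_) hε)
    exact (hςκ n).2.isometry g h
  have hγ_lip : ∀ g, IsLipschitzLinear (γ g) := fun g =>
    ⟨(hγ g).map_one_eq hF hF_fin hτ fun n => (hαn_lip n (κ n g)).1,
      fun a ha => (hγL g a ha).trans_lt (ENNReal.mul_lt_top ENNReal.coe_lt_top ha)⟩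
  have hγ1 : γ 1 = 1 :=
    (hγ 1).eq_of_tendsto hF hF_fin hτ IsLimitOperator.one
      (hKlim0 (fun n => κ n 1) (fun _ => 1) fun n => (hςκ n).2.map_one) fun n a ha => by
        simpa using hαn_K n (κ n 1) 1 a ha
  -- Both sides are limit operators, for κ_n(gh) and κ_n(g)κ_n(h), which are within ε_n of each
  -- other; K(0) = 0 makes them agree in the limit.
  have hγmul : ∀ g h, γ (g * h) = γ g * γ h := fun g h =>
    (hγ (g * h)).eq_of_tendsto hF hF_fin hτ ((hγ g).mul (hγ h))
      (hKlim0 (fun n => κ n (g * h)) (fun n => κ n g * κ n h) fun n => by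
        rw [dist_comm]
        exact (hςκ n).2.map_mul g h) fun n a ha => by
        rw [← map_mul]
        exact hαn_K n _ _ a ha
  -- Compactness of G gives the uniform norm bound needed for strong continuity.
  obtain ⟨M, hM⟩ := isCompact_univ.bddAbove_image hD.continuousOn
  have hγM : ∀ g, ‖γ g‖ ≤ M := fun g =>
    (hγn g).trans (NNReal.coe_le_coe.2 (hM ⟨g, Set.mem_univ g, rfl⟩))
  refine ⟨⟨⟨γ, hγ1⟩, hγmul⟩, continuous_apply_of_enorm_sub_le hγM hK hK0 hγK, hγ_lip, hγn, hγL,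
    fun g h => ⟨?_, ?_⟩, hγK, fun hpos g => ?_, fun hmor g => ⟨hγ_lip g, ?_, ?_⟩⟩
  · exact (hγ g).liminf_le_mkDist hF hF_fin hτ hU (hγ h) (fun n => (hαn_lip n _).1)
      fun n => (hαn_lip n _).1
  · exact (hγ g).mkDist_le_limsup hF hF_fin hτ hU (hγ h)
  · exact (hγ g).isPositiveMap hF hF_fin hτ fun n => hpos n _
  · exact (hγ g).map_mul_eq hF hF_fin hτ fun n => (hmor n _).2.1
  · exact (hγ g).map_star_eq hF hF_fin hτ fun n => (hmor n _).2.2
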